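/- A finite set of system qubits is coupled to a bath (an arbitrary Hilbert space). During a time interval $[0,T]$ the joint system evolves under the Hamiltonian $H(t)=H_S(t)+H_B(t)+H_{SB}(t)$. Here $H_S(t)$ realizes an ideal quantum circuit: a finite set of locations, each an operation on a set of qubits during a time interval of length at most $t_0$ (the maximal duration of a location), such that no qubit takes part in two locations at the same time; $H_S(t)$ is the sum of the Hamiltonians of the locations being executed at time $t$. The self-adjoint bath Hamiltonian $H_B(t)$ is unrestricted (apart from generating, together with $H_S$, a unitary evolution $U_0$). The coupling is $$H_{SB}(t)=\sum_{k\ge 1}\frac1{k!}\sum_{i_1,\dots,i_k}H^{(k)}_{i_1,\dots,i_k}(t),$$ where the bounded, measurable in time, Hermitian operator $H^{(k)}_{i_1,\dots,i_k}(t)$ acts on the $k$ qubits $i_1,\dots,i_k$ and arbitrarily on the bath, is invariant under permutations of the indices, and vanishes if two indices coincide. Expand the evolution operator over $[0,T]$ to all orders in powers of $H_{SB}$ (Dyson series around $U_0$). For a set $\mathcal I_r$ of $r$ locations let $E(\mathcal I_r)$ be the sum of all terms of the expansion in which every location in $\mathcal I_r$ is faulty, i.e. at least one of its qubits is acted on by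 at least one inserted term of $H_{SB}$ during the execution of the location. The noise has effective noise strength $\varepsilon$ if $\|E(\mathcal I_r)\|\le\varepsilon^r$ for every $r\ge 0$ and every set $\mathcal I_r$ of $r$ locations. Let $$\alpha=\max_{k\ge1}\Big(\max_{i_1,\,t}\ \sum_{i_2,\dots,i_k}\big\|H^{(k)}_{i_1,i_2,\dots,i_k}(t)\big\|\,t_0\Big)^{1/k},$$ the inner maximum (supremum) being over all system qubits $i_1$ and all times $t\in[0,T]$ and the sum over all system qubits, and suppose that $2\alpha<1$. If each location acts on at most $m$ qubits, then every $E(\mathcal I_r)$ is well defined (the expansion converges) and the noise has effective noise strength $$\varepsilon= 2m\alpha\,\big(e^{(e-1)/2}\big)^{C(\alpha)},\qquad C(\alpha)=(1-2\alpha)^{-1}.$$ (Since $\|E(\mathcal I_r)\|\le\varepsilon^r$ is an upper bound, this is the assertion that the effective noise strength is at most this number.) As $\alpha\to0^+$ this bound divided by $\alpha$ tends to $2e^{(e-1)/2}\,m$, where $|2e^{(e-1)/2}-4.72|<0.005$. -/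

import Mathlib

open Filter Topology MeasureTheory

namespace CorrelatedNoise

noncomputable section

/-- The joint Hilbert space `(ℂ²)^{⊗ Q} ⊗ B` of the system qubits `Q` and the bath `B`, written
in the computational basis: a vector is a `B`-valued function of the bit string `x : Q → Bool`,
with the `ℓ²` norm. -/
abbrev JointSpace (Q B : Type*) [Fintype Q] [DecidableEq Q] [NormedAddCommGroup B]
    [InnerProductSpace ℂ B] : Type _ :=
  PiLp 2 (fun _ : Q → Bool => B)

/-- Bounded operators on the joint Hilbert space. -/
abbrev JointOp (Q B : Type*) [Fintype Q] [DecidableEq Q] [NormedAddCommGroup B]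
    [InnerProductSpace ℂ B] : Type _ :=
  JointSpace Q B →L[ℂ] JointSpace Q B

/-- The system operator `M ⊗ 1`, where `M` is an operator of the qubits in `S` and `1` is the
identity of the other system qubits. -/
def embedMatrix {Q : Type*} [Fintype Q] [DecidableEq Q] (S : Finset Q)
    (M : Matrix (S → Bool) (S → Bool) ℂ) : Matrix (Q → Bool) (Q → Bool) ℂ :=
  fun x y => if ∀ q, q ∉ S → x q = y q then M (fun q => x q) (fun q => y q) else 0

/-- `A` acts only on the qubits in `S`, and arbitrarily on the bath: `A = K ⊗ 1`, where `K` is an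
operator of the qubits in `S` and the bath (given by its blocks `K x y : B →L[ℂ] B`), and `1` is
the identity of the system qubits outside `S`. -/
def ActsOn {Q B : Type*} [Fintype Q] [DecidableEq Q] [NormedAddCommGroup B]
    [InnerProductSpace ℂ B] (S : Finset Q) (A : JointOp Q B) : Prop :=
  ∃ K : (S → Bool) → (S → Bool) → (B →L[ℂ] B), ∀ (ψ : JointSpace Q B) (x : Q → Bool),
    A ψ x = ∑ y : Q → Bool,
      if ∀ q, q ∉ S → x q = y q then K (fun q => x q) (fun q => y q) (ψ y) else 0

/-- An ideal quantum circuit on the qubits `Q`, with set of locations `L`, run during the time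
interval `[0, T]`. A location is an operation (a gate on one or several qubits, the evolution that
follows a preparation or precedes a measurement, or an idle step) on a set of qubits during a time
interval; no qubit takes part in two locations at the same time. The operation is driven by a
time-dependent Hamiltonian of the qubits of the location. -/
structure Circuit (Q L : Type*) where
  /-- total running time -/
  T : ℝ
  T_nonneg : 0 ≤ T
  /-- the qubits on which a location acts -/
  qubits : L → Finset Q
  /-- the time at which a location starts -/
  start : L → ℝ
  /-- the time at which a location ends -/
  finish : L → ℝ
  start_nonneg : ∀ l, 0 ≤ start l
  start_le_finish : ∀ l, start l ≤ finish l
  finish_le : ∀ l, finish l ≤ T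
  disjoint : ∀ l l', l ≠ l' → ∀ q, q ∈ qubits l → q ∈ qubits l' →
    Disjoint (Set.Ico (start l) (finish l)) (Set.Ico (start l') (finish l'))
  /-- the Hamiltonian that drives a location -/
  gate : (l : L) → ℝ → Matrix (qubits l → Bool) (qubits l → Bool) ℂ
  gate_hermitian : ∀ l t, (gate l t).IsHermitian

namespace Circuit

variable {Q L : Type*}

/-- The time interval during which a location is executed. -/
def window (C : Circuit Q L) (l : L) : Set ℝ := Set.Ico (C.start l) (C.finish l)

/-- The maximal duration `t₀` of a location. -/
def maxDuration (C : Circuit Q L) : ℝ := ⨆ l, (C.finish l - C.start l)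

/-- The system Hamiltonian `H_S(t)`: the sum of the Hamiltonians of the locations that are being
executed at time `t`. -/
def systemHamiltonian [Fintype Q] [DecidableEq Q] [Fintype L] (C : Circuit Q L) (t : ℝ) :
    Matrix (Q → Bool) (Q → Bool) ℂ :=
  ∑ l, (C.window l).indicator (fun s => embedMatrix (C.qubits l) (C.gate l s)) t

end Circuit

/-- The noise: a bath Hamiltonian `H_B(t)`, any self-adjoint, possibly unbounded operator of the
bath, and a system-bath Hamiltonian `H_SB(t) = ∑_S H_S(t)`, summed over the nonempty sets `S` of
system qubits, where the Hermitian operator `H_S(t)` acts on the qubits in `S` and on the bath.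
The value of `coupling` at the empty set is not used. -/
structure Noise (Q B : Type*) [Fintype Q] [DecidableEq Q] [NormedAddCommGroup B]
    [InnerProductSpace ℂ B] [CompleteSpace B] where
  bath : ℝ → (B →ₗ.[ℂ] B)
  bath_selfAdjoint : ∀ t, IsSelfAdjoint (bath t)
  coupling : Finset Q → ℝ → JointOp Q B
  coupling_selfAdjoint : ∀ S t, IsSelfAdjoint (coupling S t)
  coupling_actsOn : ∀ S t, ActsOn S (coupling S t)
  coupling_measurable : ∀ S, StronglyMeasurable (coupling S)
  coupling_bounded : ∀ S, ∃ K : ℝ, ∀ t, ‖coupling S t‖ ≤ K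

/-- `H_S ⊗ 1 + 1 ⊗ H_B`, an operator defined on the vectors all of whose components lie in the
domain of `H_B`. -/
def freeHamiltonian {Q B : Type*} [Fintype Q] [DecidableEq Q] [NormedAddCommGroup B]
    [InnerProductSpace ℂ B] (HS : Matrix (Q → Bool) (Q → Bool) ℂ) (HB : B →ₗ.[ℂ] B) :
    JointSpace Q B →ₗ.[ℂ] JointSpace Q B where
  domain :=
    { carrier := {ψ | ∀ x, ψ x ∈ HB.domain}
      add_mem' := fun ha hb x => HB.domain.add_mem (ha x) (hb x)
      zero_mem' := fun _ => HB.domain.zero_mem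
      smul_mem' := fun c _ h x => HB.domain.smul_mem c (h x) }
  toFun :=
    { toFun := fun ψ => WithLp.toLp 2 (fun x =>
        (∑ y, HS x y • ψ.1 y) + HB ⟨ψ.1 x, ψ.2 x⟩)
      map_add' := by
        intro a b
        ext x
        have h : HB ⟨(a + b).1 x, (a + b).2 x⟩
            = HB ⟨a.1 x, a.2 x⟩ + HB ⟨b.1 x, b.2 x⟩ := by
          rw [← HB.map_add]
          rfl
        have h' : ∑ y, HS x y • (a + b).1 y = ∑ y, HS x y • a.1 y + ∑ y, HS x y • b.1 y := by
          simp only [PiLp.add_apply, Submodule.coe_add, smul_add, Finset.sum_add_distrib]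
        change (∑ y, HS x y • (a + b).1 y) + HB ⟨(a + b).1 x, (a + b).2 x⟩
          = ((∑ y, HS x y • a.1 y) + HB ⟨a.1 x, a.2 x⟩)
            + ((∑ y, HS x y • b.1 y) + HB ⟨b.1 x, b.2 x⟩)
        rw [h, h']
        abel
      map_smul' := by
        intro c a
        ext x
        have h : HB ⟨(c • a).1 x, (c • a).2 x⟩ = c • HB ⟨a.1 x, a.2 x⟩ := by
          rw [← HB.map_smul]
          rfl
        have h' : ∑ y, HS x y • (c • a).1 y = c • ∑ y, HS x y • a.1 y := by
          simp only [PiLp.smul_apply, Submodule.coe_smul, Finset.smul_sum, smul_comm c]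
        change (∑ y, HS x y • (c • a).1 y) + HB ⟨(c • a).1 x, (c • a).2 x⟩
          = c • ((∑ y, HS x y • a.1 y) + HB ⟨a.1 x, a.2 x⟩)
        rw [h, h', smul_add] }

/-- `U t` is the unitary time evolution from time `0` to time `t` that the time-dependent, possibly
unbounded Hamiltonian `H t` generates: it is strongly continuous and, for a dense set of initial
vectors and at all but countably many times (at which the Hamiltonian may be switched), it solves
the Schrödinger equation `dψ/dt = -i H(t) ψ`. -/
structure IsEvolution {E : Type*} [NormedAddCommGroup E] [InnerProductSpace ℂ E] [CompleteSpace E]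
    (H : ℝ → (E →ₗ.[ℂ] E)) (U : ℝ → (E →L[ℂ] E)) : Prop where
  unitary_mem : ∀ t, U t ∈ unitary (E →L[ℂ] E)
  map_zero : U 0 = 1
  continuous : ∀ ψ, Continuous fun t => U t ψ
  schrodinger : ∃ D : Set E, Dense D ∧ ∃ Z : Set ℝ, Z.Countable ∧ ∀ ψ ∈ D, ∀ t ∉ Z,
    ∃ h : U t ψ ∈ (H t).domain,
      HasDerivAt (fun s => U s ψ) (-Complex.I • (H t) ⟨U t ψ, h⟩) t

section Expansion

variable {Q L B : Type*} [Fintype Q] [DecidableEq Q] [NormedAddCommGroup B]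
  [InnerProductSpace ℂ B] [CompleteSpace B]

/-- The labels of the terms in an expansion in powers of `H_SB`: the order `n`, and for each of
the `n` insertions of `H_SB` the nonempty set `S` of system qubits that labels the term of `H_SB`
inserted there. -/
abbrev Word (Q : Type*) : Type _ := Σ n : ℕ, (Fin n → {S : Finset Q // S.Nonempty})

/-- Location `l` is faulty if at least one of its qubits is struck by an insertion during the
execution of `l`; the insertion number `j` is the term `w.2 j` at time `t j`. -/
def Faulty (C : Circuit Q L) (w : Word Q) (t : Fin w.1 → ℝ) (l : L) : Prop :=
  ∃ j, t j ∈ C.window l ∧ ((w.2 j : Finset Q) ∩ C.qubits l).Nonempty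

/-- The ordered insertion times `t₁ < ⋯ < tₙ` in `[0, T]` for which every location in `I` is
faulty. -/
def faultyTimes (C : Circuit Q L) (I : Finset L) (w : Word Q) : Set (Fin w.1 → ℝ) :=
  {t | StrictMono t ∧ (∀ j, t j ∈ Set.Icc 0 C.T) ∧ ∀ l ∈ I, Faulty C w t l}

/-- The term `H_S` of `H_SB` in the interaction picture of the unperturbed evolution `U₀`. -/
def interactionPicture (N : Noise Q B) (U₀ : ℝ → JointOp Q B) (S : Finset Q) (t : ℝ) :
    JointOp Q B :=
  ContinuousLinearMap.adjoint (U₀ t) * N.coupling S t * U₀ t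

/-- The integrand of the expansion of the evolution operator over `[0, T]` in powers of `H_SB`:
`(-i)ⁿ U₀(T) H̃_{Sₙ}(tₙ) ⋯ H̃_{S₁}(t₁)`. -/
def dysonIntegrand (C : Circuit Q L) (N : Noise Q B) (U₀ : ℝ → JointOp Q B) (w : Word Q)
    (t : Fin w.1 → ℝ) : JointOp Q B :=
  (-Complex.I) ^ w.1 •
    (U₀ C.T * (List.ofFn fun j => interactionPicture N U₀ (w.2 j) (t j)).reverse.prod)

/-- `E` is the sum `E(I)` of all terms in the expansion of the evolution operator in powers of
`H_SB`, to all orders, for which every location in `I` is faulty. (All integrals and sums converge,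
unconditionally, on each vector; hence this determines `E`.) -/
def IsFaultSum (C : Circuit Q L) (N : Noise Q B) (U₀ : ℝ → JointOp Q B) (I : Finset L)
    (E : JointOp Q B) : Prop :=
  ∀ ψ : JointSpace Q B,
    (∀ w : Word Q, IntegrableOn (fun t => dysonIntegrand C N U₀ w t ψ) (faultyTimes C I w)) ∧
    HasSum (fun w : Word Q => ∫ t in faultyTimes C I w, dysonIntegrand C N U₀ w t ψ) (E ψ)

/-- The noise has effective noise strength `ε`: for every set `I` of `r` locations the operator
`E(I)` exists and `‖E(I)‖ ≤ ε ^ r`. -/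
def HasEffectiveNoiseStrength (C : Circuit Q L) (N : Noise Q B) (U₀ : ℝ → JointOp Q B) (ε : ℝ) :
    Prop :=
  ∀ I : Finset L, ∃ E : JointOp Q B, IsFaultSum C N U₀ I E ∧ ‖E‖ ≤ ε ^ I.card

/-- The coupling `H^{(k)}_{i₁,…,i_k}(t)` with ordered indices: invariant under permutations of the
indices, and zero if two of them coincide. -/
def tupleCoupling (N : Noise Q B) {k : ℕ} (i : Fin k → Q) (t : ℝ) : JointOp Q B :=
  if Function.Injective i then N.coupling (Finset.univ.image i) t else 0

/-- For `k = n + 1`, the number `max_{i₁} ∑_{i₂,…,i_k} ‖H^{(k)}_{i₁,i₂,…,i_k}‖ t₀`, where the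
maximum (supremum) is over all system qubits `i₁` and all times in `[0, T]`. -/
def couplingStrength (C : Circuit Q L) (N : Noise Q B) (n : ℕ) : ℝ :=
  ⨆ p : Q × Set.Icc (0 : ℝ) C.T,
    (∑ i : Fin n → Q, ‖tupleCoupling N (Fin.cons p.1 i : Fin (n + 1) → Q) p.2‖) * C.maxDuration

/-- `α = max_{k ≥ 1} (max_{i₁} ∑_{i₂,…,i_k} ‖H^{(k)}_{i₁,i₂,…,i_k}‖ t₀)^{1/k}`, with
`k = n + 1`. -/
def alpha (C : Circuit Q L) (N : Noise Q B) : ℝ :=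
  ⨆ n : ℕ, couplingStrength C N n ^ (1 / ((n : ℝ) + 1))

end Expansion

/-- `2 m α (e^{(e-1)/2})^{C(α)}` with `C(α) = (1 - 2 α)⁻¹`. -/
def strengthBound (m : ℕ) (α : ℝ) : ℝ :=
  2 * m * α * Real.exp ((Real.exp 1 - 1) / 2) ^ (1 - 2 * α)⁻¹

end

end CorrelatedNoise

/-! Split the evolution over `[0, t]`, in the interaction picture, according to the locations that
are hit: let `x_I(t)` be the sum of all terms of the Dyson series over `[0, t]` in which every
location in `I` is hit, applied to a vector `ψ`. Splitting off the last insertion gives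
`x_I' = ∑ S, A_S x_{I \ hits}`, where `A_S` is skew-adjoint and `hits` are the locations in `I` that
the insertion of `S` at time `t` hits. By skew-adjointness the insertions without hits do not
contribute to the derivative of `‖x_I‖`, and the others refer to smaller sets. By induction on `I`
it follows that `‖x_I(t)‖ ≤ (∏ l ∈ I, h_l(t)) ‖ψ‖`, where `h_l = δ + ∫ r_l` and `r_l` bounds the
rate at which `l` is hit. An insertion of `S` hits at most `|S|` locations; the weight
`ρ ^ (|S| - 1)` in the rate, with `ρ δ ≥ 1`, compensates for the missing factors if it hits more
than one.

The weighted rate of a location, multiplied by its duration, is at most `m α e^{α ρ}`. Letting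
`δ → m α` gives `‖E(I)‖ ≤ ((1 + e) m α) ^ r`, and `1 + e ≤ 2 e^{(e-1)/2}`. -/

namespace CorrelatedNoise

noncomputable section

section Energy

lemma le_of_ae_deriv_le {f g : ℝ → ℝ} {a b : ℝ} (hab : a ≤ b)
    (hf : AbsolutelyContinuousOnInterval f a b) (hg : AbsolutelyContinuousOnInterval g a b)
    (hfg : ∀ᵐ t, t ∈ Set.Ioo a b → deriv f t ≤ deriv g t) (ha : f a ≤ g a) : f b ≤ g b := by
  have hmono : ∫ t in a..b, deriv f t ≤ ∫ t in a..b, deriv g t :=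
    intervalIntegral.integral_mono_ae_restrict hab hf.intervalIntegrable_deriv
      hg.intervalIntegrable_deriv <| by
        rwa [← restrict_Ioo_eq_restrict_Icc, EventuallyLE, ae_restrict_iff' measurableSet_Ioo]
  rw [hf.integral_deriv_eq_sub, hg.integral_deriv_eq_sub] at hmono
  linarith

variable {E : Type*} [NormedAddCommGroup E]

lemma lipschitzOnWith_of_eq_add_integral [NormedSpace ℝ E] {x x' : ℝ → E} {a b : ℝ} {K : NNReal}
    (hx' : IntervalIntegrable x' volume a b) (hK : ∀ t ∈ Set.Icc a b, ‖x' t‖ ≤ K)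
    (hx : ∀ t ∈ Set.Icc a b, x t = x a + ∫ τ in a..t, x' τ) :
    LipschitzOnWith K x (Set.Icc a b) := by
  have hint : ∀ {t}, t ∈ Set.Icc a b → IntervalIntegrable x' volume a t := fun ht =>
    hx'.mono_set (Set.uIcc_subset_uIcc Set.left_mem_uIcc (Set.Icc_subset_uIcc ht))
  refine LipschitzOnWith.of_dist_le_mul fun s hs t ht => ?_
  rw [dist_comm, dist_eq_norm, hx t ht, hx s hs, add_sub_add_left_eq_sub,
    intervalIntegral.integral_interval_sub_left (hint ht) (hint hs), dist_comm, Real.dist_eq]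
  refine intervalIntegral.norm_integral_le_of_norm_le_const fun τ hτ => hK τ ?_
  exact Set.uIcc_subset_Icc hs ht (Set.uIoc_subset_uIcc hτ)

lemma ae_hasDerivAt_of_eq_add_integral [NormedSpace ℝ E] [CompleteSpace E] {x x' : ℝ → E}
    {a b : ℝ} (hx' : IntervalIntegrable x' volume a b)
    (hx : ∀ t ∈ Set.Icc a b, x t = x a + ∫ τ in a..t, x' τ) :
    ∀ᵐ t, t ∈ Set.Ioo a b → HasDerivAt x (x' t) t := by
  filter_upwards [hx'.ae_hasDerivAt_integral] with t ht hmem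
  have hderiv := ht (Set.Icc_subset_uIcc (Set.Ioo_subset_Icc_self hmem)) a Set.left_mem_uIcc
  refine (hderiv.const_add (x a)).congr_of_eventuallyEq ?_
  filter_upwards [Ioo_mem_nhds hmem.1 hmem.2] with s hs
  exact hx s (Set.Ioo_subset_Icc_self hs)

lemma deriv_norm_le_of_inner_le [InnerProductSpace ℝ E] {x : ℝ → E} {x' : E} {t r : ℝ}
    (hx : HasDerivAt x x' t) (hnorm : DifferentiableAt ℝ (fun s => ‖x s‖) t)
    (hr : 0 ≤ r) (h : inner ℝ (x t) x' ≤ ‖x t‖ * r) : deriv (fun s => ‖x s‖) t ≤ r := by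
  rcases eq_or_ne (x t) 0 with h0 | h0
  · have hmin : IsLocalMin (fun s => ‖x s‖) t := .of_forall fun s => by simp [h0]
    exact hmin.deriv_eq_zero.trans_le hr
  · have hsq : 2 * ‖x t‖ * deriv (fun s => ‖x s‖) t = 2 * inner ℝ (x t) x' := by
      simpa using (hnorm.hasDerivAt.pow 2).unique hx.norm_sq
    have hpos : 0 < ‖x t‖ := norm_pos_iff.2 h0
    exact le_of_mul_le_mul_left (by linarith) hpos

lemma norm_le_of_ae_inner_le [InnerProductSpace ℝ E] {x x' : ℝ → E} {R R' : ℝ → ℝ} {a b : ℝ}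
    {K : NNReal} (hab : a ≤ b) (hxL : LipschitzOnWith K x (Set.Icc a b))
    (hx : ∀ᵐ t, t ∈ Set.Ioo a b → HasDerivAt x (x' t) t)
    (hRac : AbsolutelyContinuousOnInterval R a b)
    (hR : ∀ᵐ t, t ∈ Set.Ioo a b → HasDerivAt R (R' t) t)
    (hR' : ∀ t ∈ Set.Ioo a b, 0 ≤ R' t)
    (h : ∀ t ∈ Set.Ioo a b, inner ℝ (x t) (x' t) ≤ ‖x t‖ * R' t) (ha : ‖x a‖ ≤ R a) :
    ‖x b‖ ≤ R b := by
  have hac : AbsolutelyContinuousOnInterval (fun t => ‖x t‖) a b := by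
    rw [← Set.uIcc_of_le hab] at hxL
    exact (lipschitzWith_one_norm.comp_lipschitzOnWith hxL).absolutelyContinuousOnInterval
  refine le_of_ae_deriv_le hab hac hRac ?_ ha
  filter_upwards [hx, hR, hac.ae_differentiableAt] with t hxt hRt hnorm ht
  rw [(hRt ht).deriv]
  exact deriv_norm_le_of_inner_le (hxt ht)
    (hnorm (Set.Icc_subset_uIcc (Set.Ioo_subset_Icc_self ht))) (hR' t ht) (h t ht)

lemma absolutelyContinuousOnInterval_finsetProd {ι : Type*} {f : ι → ℝ → ℝ} {a b : ℝ}
    (hf : ∀ i, AbsolutelyContinuousOnInterval (f i) a b) (s : Finset ι) :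
    AbsolutelyContinuousOnInterval (fun t => ∏ i ∈ s, f i t) a b := by
  classical
  induction s using Finset.induction_on with
  | empty => exact (LipschitzWith.const (1 : ℝ)).lipschitzOnWith.absolutelyContinuousOnInterval
  | insert i s hi ih => simpa only [Finset.prod_insert hi] using (hf i).fun_mul ih

section Primitive

variable {ι : Type*} {r : ι → ℝ → ℝ} {δ a b : ℝ}

lemma absolutelyContinuousOnInterval_prod_add_integral
    (hr : ∀ i, IntervalIntegrable (r i) volume a b) (s : Finset ι) :
    AbsolutelyContinuousOnInterval (fun t => ∏ i ∈ s, (δ + ∫ τ in a..t, r i τ)) a b :=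
  absolutelyContinuousOnInterval_finsetProd (fun i =>
    (LipschitzWith.const δ).lipschitzOnWith.absolutelyContinuousOnInterval.fun_add
      ((hr i).absolutelyContinuousOnInterval_intervalIntegral Set.left_mem_uIcc)) s

lemma ae_hasDerivAt_prod_add_integral [DecidableEq ι]
    (hr : ∀ i, IntervalIntegrable (r i) volume a b) (s : Finset ι) :
    ∀ᵐ t, t ∈ Set.Ioo a b → HasDerivAt (fun t => ∏ i ∈ s, (δ + ∫ τ in a..t, r i τ))
      (∑ i ∈ s, (∏ j ∈ s.erase i, (δ + ∫ τ in a..t, r j τ)) * r i t) t := by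
  have hderiv : ∀ i ∈ s, ∀ᵐ t, t ∈ Set.Ioo a b →
      HasDerivAt (fun t => δ + ∫ τ in a..t, r i τ) (r i t) t := fun i _ =>
    ae_hasDerivAt_of_eq_add_integral (hr i) fun t _ => by simp
  filter_upwards [(Finset.eventually_all s).2 hderiv] with t ht hmem
  exact HasDerivAt.fun_finsetProd fun i hi => ht i hi hmem

end Primitive

end Energy

lemma stronglyMeasurable_clm_apply {Ω 𝕜 E F : Type*} [MeasurableSpace Ω]
    [NontriviallyNormedField 𝕜] [NormedAddCommGroup E] [NormedSpace 𝕜 E] [NormedAddCommGroup F]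
    [NormedSpace 𝕜 F] {A : Ω → E →L[𝕜] F} {φ : Ω → E}
    (hA : ∀ x, StronglyMeasurable fun ω => A ω x) (hφ : StronglyMeasurable φ) :
    StronglyMeasurable fun ω => A ω (φ ω) := by
  have hsimple : ∀ f : SimpleFunc Ω E, StronglyMeasurable fun ω => A ω (f ω) := fun f => by
    induction f using SimpleFunc.induction with
    | @const c s hs =>
      convert (hA c).indicator hs using 2 with ω
      by_cases hω : ω ∈ s <;> simp [hω]
    | @add f g _ hf hg =>
      simp only [SimpleFunc.coe_add, Pi.add_apply, map_add]
      exact hf.add hg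
  exact stronglyMeasurable_of_tendsto atTop (fun n => hsimple (hφ.approx n))
    (tendsto_pi_nhds.2 fun ω => ((A ω).continuous.tendsto _).comp (hφ.tendsto_approx ω))

lemma strictMono_snoc_iff {α : Type*} [Preorder α] {n : ℕ} {f : Fin n → α} {a : α} :
    StrictMono (Fin.snoc f a : Fin (n + 1) → α) ↔ StrictMono f ∧ ∀ i, f i < a := by
  simp only [StrictMono, Fin.forall_fin_succ', Fin.snoc_castSucc, Fin.snoc_last,
    Fin.castSucc_lt_castSucc_iff, Fin.castSucc_lt_last, (Fin.castSucc_lt_last _).not_gt,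
    forall_true_left, forall_and, lt_irrefl, false_imp_iff, implies_true, and_true]

lemma integral_finSnoc {E : Type*} [NormedAddCommGroup E] [NormedSpace ℝ E] {n : ℕ}
    {f : (Fin (n + 1) → ℝ) → E} (hf : Integrable f) :
    ∫ t, f t = ∫ τ : ℝ, ∫ t : Fin n → ℝ, f (Fin.snoc t τ) := by
  have he := (volume_preserving_piFinSuccAbove (fun _ : Fin (n + 1) => ℝ) (Fin.last n)).symm _
  have hf' := (he.integrable_comp_emb (MeasurableEquiv.measurableEmbedding _)).2 hf
  rw [← he.integral_comp', Measure.volume_eq_prod, integral_prod _ (by exact hf')]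
  simp only [MeasurableEquiv.piFinSuccAbove_symm_apply, Fin.insertNthEquiv, Equiv.coe_fn_mk,
    Fin.insertNth_last']

section Words

variable {σ E : Type*} [AddCommMonoid E] [TopologicalSpace E] [ContinuousAdd E]

lemma hasSum_prod_of_fintype {ι β : Type*} [Fintype ι] {f : β × ι → E} {g : ι → E}
    (h : ∀ i, HasSum (fun b => f (b, i)) (g i)) : HasSum f (∑ i, g i) := by
  have hinj : ∀ i : ι, Function.Injective fun b : β => (b, i) := fun i => Prod.mk_left_injective i
  have hf : f = fun p => ∑ i, Function.extend (fun b => (b, i)) (fun b => f (b, i)) 0 p := by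
    ext ⟨b, i⟩
    rw [Finset.sum_eq_single i, (hinj i).extend_apply]
    · intro j _ hj
      exact Function.extend_apply' _ _ _ fun ⟨c, hc⟩ => hj (congrArg Prod.snd hc)
    · simp
  rw [hf]
  exact hasSum_sum fun i _ => (hasSum_extend_zero (hinj i)).2 (h i)

lemma hasSum_words [Fintype σ] {f : (Σ n : ℕ, Fin n → σ) → E} {g : σ → E}
    (h : ∀ S, HasSum (fun w : Σ n : ℕ, Fin n → σ => f ⟨w.1 + 1, Fin.snoc w.2 S⟩) (g S)) :
    HasSum f (f ⟨0, Fin.elim0⟩ + ∑ S, g S) := by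
  let e : (Fin 0 → σ) ⊕ ((Σ n : ℕ, Fin n → σ) × σ) ≃ Σ n : ℕ, Fin n → σ :=
    (Equiv.sumCongr (.refl _) ((Equiv.sigmaProdDistrib _ _).trans (.sigmaCongrRight fun n =>
      (Equiv.prodComm _ _).trans (Fin.snocEquiv fun _ => σ)))).trans
      (Equiv.sigmaNatSucc fun n => Fin n → σ).symm
  refine e.hasSum_iff.1 (.sum ?_ (hasSum_prod_of_fintype h))
  convert hasSum_fintype _
  rw [Fintype.sum_unique]
  exact congrArg f (Sigma.ext rfl (heq_of_eq (Subsingleton.elim _ _)))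

lemma summable_words_pow_div_factorial [Finite σ] {b : ℝ} (hb : 0 ≤ b) :
    Summable fun w : Σ n : ℕ, Fin n → σ => b ^ w.1 / w.1.factorial := by
  have := Fintype.ofFinite σ
  refine (summable_sigma_of_nonneg fun w => by positivity).2 ⟨fun n => .of_finite, ?_⟩
  convert Real.summable_pow_div_factorial (Fintype.card σ * b) using 2 with n
  simp [mul_pow, mul_div_assoc]

end Words

/-- A family of time-dependent operators, uniformly bounded and measurable in time, together with
the locations that the insertion of each of them at each time hits. -/
structure Perturbation (σ L H : Type*) [NormedAddCommGroup H] [NormedSpace ℂ H] where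
  op : σ → ℝ → H →L[ℂ] H
  hit : σ → ℝ → L → Prop
  bound : NNReal
  stronglyMeasurable_op : ∀ S ψ, StronglyMeasurable fun t => op S t ψ
  norm_op_le : ∀ S t, ‖op S t‖ ≤ bound
  measurableSet_hit : ∀ S l, MeasurableSet {t | hit S t l}

namespace Perturbation

variable {σ L H : Type*} [NormedAddCommGroup H] [NormedSpace ℂ H] (P : Perturbation σ L H)

open Classical in
/-- The locations in `I` that are hit by the insertion of `S` at time `t`. -/
def hits (I : Finset L) (S : σ) (t : ℝ) : Finset L := I.filter (P.hit S t)

/-- The ordered insertion times in `[0, s)` for which every location in `I` is hit. -/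
def times (I : Finset L) {n : ℕ} (w : Fin n → σ) (s : ℝ) : Set (Fin n → ℝ) :=
  {t | StrictMono t ∧ (∀ j, t j ∈ Set.Ico 0 s) ∧ ∀ l ∈ I, ∃ j, P.hit (w j) (t j) l}

/-- The time-ordered product of the inserted operators, applied to `ψ`. -/
def integrand {n : ℕ} (w : Fin n → σ) (t : Fin n → ℝ) (ψ : H) : H :=
  (List.ofFn fun j => P.op (w j) (t j)).reverse.prod ψ

/-- The term of the Dyson series up to time `s` with insertions `w`, restricted to the insertion
times for which every location in `I` is hit. -/
def term (I : Finset L) {n : ℕ} (w : Fin n → σ) (s : ℝ) (ψ : H) : H :=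
  ∫ t in P.times I w s, P.integrand w t ψ

/-- The sum of all terms of the Dyson series up to time `s` for which every location in `I` is
hit. -/
def total (I : Finset L) (s : ℝ) (ψ : H) : H := ∑' w : Σ n : ℕ, Fin n → σ, P.term I w.2 s ψ

open Classical in
/-- The rate at which the location `l` is hit at time `t`, where an insertion of `S` counts with
the weight `g S`. -/
def hitRate [Fintype σ] (g : σ → ℝ) (l : L) (t : ℝ) : ℝ :=
  ∑ S with P.hit S t l, ‖P.op S t‖ * g S

lemma mem_hits {I : Finset L} {S : σ} {t : ℝ} {l : L} :
    l ∈ P.hits I S t ↔ l ∈ I ∧ P.hit S t l := by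
  simp [hits]

lemma hits_subset (I : Finset L) (S : σ) (t : ℝ) : P.hits I S t ⊆ I := by
  simp [hits]

lemma one_le_weight {g : σ → ℝ} {δ : ℝ}
    (hg : ∀ I S t, 1 ≤ g S * δ ^ ((P.hits I S t).card - 1)) (S : σ) : 1 ≤ g S := by
  simpa [hits] using hg ∅ S 0

lemma hitRate_nonneg [Fintype σ] {g : σ → ℝ} (hg : ∀ S, 1 ≤ g S) (l : L) (t : ℝ) :
    0 ≤ P.hitRate g l t :=
  Finset.sum_nonneg fun S _ => mul_nonneg (norm_nonneg _) (zero_le_one.trans (hg S))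

section Integrand

variable {n : ℕ} (w : Fin n → σ) (t : Fin n → ℝ)

lemma integrand_elim0 (ψ : H) (w : Fin 0 → σ) (t : Fin 0 → ℝ) : P.integrand w t ψ = ψ := by
  simp [integrand]

lemma integrand_snoc (S : σ) (τ : ℝ) (ψ : H) :
    P.integrand (Fin.snoc w S : Fin (n + 1) → σ) (Fin.snoc t τ : Fin (n + 1) → ℝ) ψ =
      P.op S τ (P.integrand w t ψ) := by
  simp only [integrand, List.ofFn_succ', List.concat_eq_append, List.reverse_append,
    List.reverse_singleton, List.singleton_append, List.prod_cons, Fin.snoc_castSucc, Fin.snoc_last]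
  rfl

lemma integrand_add (ψ φ : H) :
    P.integrand w t (ψ + φ) = P.integrand w t ψ + P.integrand w t φ := map_add _ _ _

lemma integrand_smul (c : ℂ) (ψ : H) : P.integrand w t (c • ψ) = c • P.integrand w t ψ :=
  map_smul _ _ _

lemma norm_integrand_le (ψ : H) : ‖P.integrand w t ψ‖ ≤ P.bound ^ n * ‖ψ‖ := by
  refine ContinuousLinearMap.le_of_opNorm_le _ ?_ ψ
  induction n with
  | zero =>
    simp only [List.ofFn_zero, List.reverse_nil, List.prod_nil, pow_zero]
    exact ContinuousLinearMap.norm_id_le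
  | succ n ih =>
    simp only [List.ofFn_succ', List.concat_eq_append, List.reverse_append, List.reverse_singleton,
      List.singleton_append, List.prod_cons, pow_succ']
    exact (norm_mul_le _ _).trans (mul_le_mul (P.norm_op_le _ _) (ih _ _) (norm_nonneg _)
      P.bound.coe_nonneg)

lemma stronglyMeasurable_integrand (ψ : H) : StronglyMeasurable fun t => P.integrand w t ψ := by
  induction n with
  | zero => simpa only [integrand_elim0] using stronglyMeasurable_const
  | succ n ih =>
    have hsplit : ∀ t : Fin (n + 1) → ℝ, P.integrand w t ψ =
        P.op (w (Fin.last n)) (t (Fin.last n)) (P.integrand (Fin.init w) (Fin.init t) ψ) :=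
      fun t => by rw [← integrand_snoc, Fin.snoc_init_self, Fin.snoc_init_self]
    simp only [hsplit]
    refine stronglyMeasurable_clm_apply (fun φ => ?_) ((ih _).comp_measurable ?_)
    · exact (P.stronglyMeasurable_op _ φ).comp_measurable (measurable_pi_apply _)
    · exact measurable_pi_lambda _ fun j => measurable_pi_apply _

end Integrand

section Times

variable {n : ℕ} (w : Fin n → σ)

lemma snoc_mem_times_iff [DecidableEq L] {I : Finset L} {S : σ} {s τ : ℝ} {t : Fin n → ℝ} :
    (Fin.snoc t τ : Fin (n + 1) → ℝ) ∈ P.times I (Fin.snoc w S : Fin (n + 1) → σ) s ↔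
      τ ∈ Set.Ico 0 s ∧ t ∈ P.times (I \ P.hits I S τ) w τ := by
  simp only [times, Set.mem_ofPred_eq, strictMono_snoc_iff, Fin.forall_fin_succ',
    Fin.exists_fin_succ', Fin.snoc_castSucc, Fin.snoc_last, Finset.mem_sdiff, mem_hits, Set.mem_Ico]
  grind

lemma measurableSet_times_prod {I : Finset L} {J : ℝ → Finset L} (hJI : ∀ τ, J τ ⊆ I)
    (hJ : ∀ l, MeasurableSet {τ | l ∈ J τ}) :
    MeasurableSet {p : ℝ × (Fin n → ℝ) | p.2 ∈ P.times (J p.1) w p.1} := by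
  have hj : ∀ j : Fin n, Measurable fun p : ℝ × (Fin n → ℝ) => p.2 j :=
    fun j => (measurable_pi_apply j).comp measurable_snd
  have hset : {p : ℝ × (Fin n → ℝ) | p.2 ∈ P.times (J p.1) w p.1} =
      (⋂ (i : Fin n) (j : Fin n) (_ : i < j), {p | p.2 i < p.2 j}) ∩
      ((⋂ j : Fin n, {p | 0 ≤ p.2 j} ∩ {p | p.2 j < p.1}) ∩
        ⋂ l ∈ I, {p | l ∈ J p.1}ᶜ ∪ ⋃ j : Fin n, {p | P.hit (w j) (p.2 j) l}) := by
    ext p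
    simp only [times, StrictMono, Set.mem_Ico, Set.mem_ofPred_eq, Set.mem_inter_iff,
      Set.mem_iInter, Set.mem_union, Set.mem_compl_iff, Set.mem_iUnion]
    grind
  rw [hset]
  refine .inter ?_ (.inter ?_ ?_)
  · exact .iInter fun i => .iInter fun j => .iInter fun _ => measurableSet_lt (hj i) (hj j)
  · exact .iInter fun j => (measurableSet_le measurable_const (hj j)).inter
      (measurableSet_lt (hj j) measurable_fst)
  · exact .biInter I.countable_toSet fun l _ => (measurable_fst (hJ l)).compl.union
      (.iUnion fun j => hj j (P.measurableSet_hit (w j) l))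

lemma measurableSet_times (I : Finset L) (s : ℝ) : MeasurableSet (P.times I w s) :=
  measurable_prodMk_left (x := s)
    (P.measurableSet_times_prod w (fun _ => Finset.Subset.refl I) fun _ => .const _)

lemma volume_times_ne_top (I : Finset L) (s : ℝ) : volume (P.times I w s) ≠ ⊤ := by
  have hsub : P.times I w s ⊆ Set.pi Set.univ fun _ => Set.Ico 0 s := fun _ ht j _ => ht.2.1 j
  refine ((measure_mono hsub).trans_lt ?_).ne
  rw [volume_pi_pi]
  exact ENNReal.prod_lt_top fun j _ => measure_Ico_lt_top

lemma integrableOn_integrand (I : Finset L) (s : ℝ) (ψ : H) :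
    IntegrableOn (fun t => P.integrand w t ψ) (P.times I w s) :=
  Measure.integrableOn_of_bounded (P.volume_times_ne_top w I s)
    (P.stronglyMeasurable_integrand w ψ).aestronglyMeasurable
    (ae_of_all _ fun t => P.norm_integrand_le w t ψ)

lemma measurableSet_mem_sdiff_hits [DecidableEq L] (I : Finset L) (S : σ) (l : L) :
    MeasurableSet {τ | l ∈ I \ P.hits I S τ} := by
  have hset : {τ | l ∈ I \ P.hits I S τ} = {_τ | l ∈ I} ∩ {τ | P.hit S τ l}ᶜ := by
    ext τ
    simp only [Finset.mem_sdiff, mem_hits, Set.mem_ofPred_eq, Set.mem_inter_iff, Set.mem_compl_iff]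
    tauto
  rw [hset]
  exact (MeasurableSet.const _).inter (P.measurableSet_hit S l).compl

end Times

section Term

variable {n : ℕ} (I : Finset L) (w : Fin n → σ)

lemma term_elim0 [DecidableEq L] [CompleteSpace H] (w : Fin 0 → σ) (s : ℝ) (ψ : H) :
    P.term I w s ψ = if I = ∅ then ψ else 0 := by
  have htimes : P.times I w s = {_t | I = ∅} := by
    ext t
    simp [times, StrictMono, Finset.eq_empty_iff_forall_notMem]
  have hvol : (volume : Measure (Fin 0 → ℝ)).real Set.univ = 1 := by
    simp [measureReal_def, volume_pi]
  rw [term, htimes]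
  split_ifs with hI <;> simp [hI, integrand_elim0, hvol]

lemma term_snoc [DecidableEq L] [CompleteSpace H] (S : σ) {s : ℝ} (hs : 0 ≤ s) (ψ : H) :
    P.term I (Fin.snoc w S : Fin (n + 1) → σ) s ψ =
      ∫ τ in 0..s, P.op S τ (P.term (I \ P.hits I S τ) w τ ψ) := by
  let w' : Fin (n + 1) → σ := Fin.snoc w S
  have hsplit : ∀ τ (t : Fin n → ℝ),
      (P.times I w' s).indicator (fun t => P.integrand w' t ψ) (Fin.snoc t τ) =
        (Set.Ico 0 s).indicator (fun τ => (P.times (I \ P.hits I S τ) w τ).indicator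
          (fun t => P.op S τ (P.integrand w t ψ)) t) τ := fun τ t => by
    classical
    simp only [Set.indicator_apply, w', snoc_mem_times_iff, integrand_snoc, ite_and]
  have hinner : ∀ τ, ∫ t : Fin n → ℝ,
      (P.times I w' s).indicator (fun t => P.integrand w' t ψ) (Fin.snoc t τ) =
        (Set.Ico 0 s).indicator (fun τ => P.op S τ (P.term (I \ P.hits I S τ) w τ ψ)) τ :=
      fun τ => by
    simp only [hsplit]
    by_cases hτ : τ ∈ Set.Ico 0 s
    · simp only [Set.indicator_of_mem hτ]
      rw [integral_indicator (P.measurableSet_times w _ τ),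
        ContinuousLinearMap.integral_comp_comm _ (P.integrableOn_integrand w _ τ ψ), term]
    · simp only [Set.indicator_of_notMem hτ, integral_zero]
  rw [term, ← integral_indicator (P.measurableSet_times w' I s), integral_finSnoc
    ((P.integrableOn_integrand w' I s ψ).integrable_indicator (P.measurableSet_times w' I s))]
  simp only [hinner]
  rw [integral_indicator measurableSet_Ico, integral_Ico_eq_integral_Ioc,
    intervalIntegral.integral_of_le hs]

lemma norm_term_le [CompleteSpace H] {s : ℝ} (hs : 0 ≤ s) (ψ : H) :
    ‖P.term I w s ψ‖ ≤ (P.bound * s) ^ n / n.factorial * ‖ψ‖ := by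
  classical
  induction n generalizing I s with
  | zero =>
    rw [term_elim0]
    split_ifs <;> simp
  | succ n ih =>
    rw [← Fin.snoc_init_self w, P.term_snoc I _ _ hs]
    have hbound : ∀ τ ∈ Set.Ioc 0 s,
        ‖P.op (w (Fin.last n)) τ (P.term (I \ P.hits I (w (Fin.last n)) τ) (Fin.init w) τ ψ)‖ ≤
          P.bound * ((P.bound * τ) ^ n / n.factorial * ‖ψ‖) := fun τ hτ =>
      (ContinuousLinearMap.le_of_opNorm_le _ (P.norm_op_le _ _) _).trans
        (mul_le_mul_of_nonneg_left (ih _ _ hτ.1.le) P.bound.coe_nonneg)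
    refine (intervalIntegral.norm_integral_le_of_norm_le hs (ae_of_all _ hbound)
      (Continuous.intervalIntegrable (by fun_prop) _ _)).trans_eq ?_
    simp only [mul_pow, Nat.factorial_succ, Nat.cast_mul, Nat.cast_succ,
      intervalIntegral.integral_const_mul, intervalIntegral.integral_mul_const,
      intervalIntegral.integral_div, integral_pow]
    have : (n.factorial : ℝ) ≠ 0 := by positivity
    field_simp
    ring

lemma norm_op_term_le [CompleteSpace H] (S : σ) {s t : ℝ} (ht : t ∈ Set.Icc 0 s) (ψ : H) :
    ‖P.op S t (P.term I w t ψ)‖ ≤ P.bound * ((P.bound * s) ^ n / n.factorial * ‖ψ‖) := by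
  refine ContinuousLinearMap.le_of_opNorm_le_of_le _ (P.norm_op_le S t)
    ((P.norm_term_le I w ht.1 ψ).trans ?_)
  have := ht.1
  gcongr
  exact ht.2

lemma stronglyMeasurable_term {J : ℝ → Finset L} (hJI : ∀ τ, J τ ⊆ I)
    (hJ : ∀ l, MeasurableSet {τ | l ∈ J τ}) (ψ : H) :
    StronglyMeasurable fun τ => P.term (J τ) w τ ψ := by
  have hmeas : StronglyMeasurable fun p : ℝ × (Fin n → ℝ) =>
      (P.times (J p.1) w p.1).indicator (fun t => P.integrand w t ψ) p.2 :=
    ((P.stronglyMeasurable_integrand w ψ).comp_measurable measurable_snd).indicator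
      (P.measurableSet_times_prod w hJI hJ)
  simp only [term, ← integral_indicator (P.measurableSet_times w _ _)]
  exact hmeas.integral_prod_right

lemma stronglyMeasurable_op_term [DecidableEq L] (S : σ) (ψ : H) :
    StronglyMeasurable fun t => P.op S t (P.term (I \ P.hits I S t) w t ψ) :=
  stronglyMeasurable_clm_apply (P.stronglyMeasurable_op S) <|
    P.stronglyMeasurable_term I w (fun _ => Finset.sdiff_subset)
      (P.measurableSet_mem_sdiff_hits I S) ψ

lemma term_add (s : ℝ) (ψ φ : H) :
    P.term I w s (ψ + φ) = P.term I w s ψ + P.term I w s φ := by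
  simp only [term, integrand_add]
  exact integral_add (P.integrableOn_integrand w I s ψ) (P.integrableOn_integrand w I s φ)

lemma term_smul (s : ℝ) (c : ℂ) (ψ : H) : P.term I w s (c • ψ) = c • P.term I w s ψ := by
  simp only [term, integrand_smul]
  exact integral_smul c _

end Term

section Total

variable [Finite σ] (I : Finset L) {s : ℝ}

lemma summable_norm_bound (hs : 0 ≤ s) (ψ : H) : Summable fun w : Σ n : ℕ, Fin n → σ =>
    (P.bound * s) ^ w.1 / w.1.factorial * ‖ψ‖ :=
  (summable_words_pow_div_factorial (mul_nonneg P.bound.coe_nonneg hs)).mul_right _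

variable [CompleteSpace H]

lemma summable_term (hs : 0 ≤ s) (ψ : H) :
    Summable fun w : Σ n : ℕ, Fin n → σ => P.term I w.2 s ψ :=
  .of_norm_bounded (P.summable_norm_bound hs ψ) fun w => P.norm_term_le I w.2 hs ψ

lemma total_add (hs : 0 ≤ s) (ψ φ : H) :
    P.total I s (ψ + φ) = P.total I s ψ + P.total I s φ := by
  simp only [total, term_add]
  exact (P.summable_term I hs ψ).tsum_add (P.summable_term I hs φ)

lemma total_smul (hs : 0 ≤ s) (c : ℂ) (ψ : H) : P.total I s (c • ψ) = c • P.total I s ψ := by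
  simp only [total, term_smul]
  exact (P.summable_term I hs ψ).tsum_const_smul c

/-- `total` as a continuous linear map. -/
def totalCLM (hs : 0 ≤ s) : H →L[ℂ] H :=
  LinearMap.mkContinuous
    { toFun := P.total I s
      map_add' := P.total_add I hs
      map_smul' := P.total_smul I hs }
    (∑' w : Σ n : ℕ, Fin n → σ, (P.bound * s) ^ w.1 / w.1.factorial)
    fun ψ => tsum_mul_right (a := ‖ψ‖) ▸ tsum_of_norm_bounded
      (P.summable_norm_bound hs ψ).hasSum fun w => P.norm_term_le I w.2 hs ψ

section LastInsertion

variable (S : σ) (ψ : H)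

lemma hasSum_op_total {t : ℝ} (ht : 0 ≤ t) : HasSum
    (fun w : Σ n : ℕ, Fin n → σ => P.op S t (P.term I w.2 t ψ)) (P.op S t (P.total I t ψ)) :=
  (P.op S t).hasSum (P.summable_term I ht ψ).hasSum

lemma norm_op_total_le {t : ℝ} (ht : t ∈ Set.Icc 0 s) :
    ‖P.op S t (P.total I t ψ)‖ ≤ ∑' w : Σ n : ℕ, Fin n → σ,
      P.bound * ((P.bound * s) ^ w.1 / w.1.factorial * ‖ψ‖) :=
  (P.hasSum_op_total I S ψ ht.1).tsum_eq ▸ tsum_of_norm_bounded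
    ((P.summable_norm_bound (ht.1.trans ht.2) ψ).mul_left _).hasSum
    fun w => P.norm_op_term_le I w.2 S ht ψ

variable [DecidableEq L]

lemma intervalIntegrable_op_total (hs : 0 ≤ s) :
    IntervalIntegrable (fun t => P.op S t (P.total (I \ P.hits I S t) t ψ)) volume 0 s := by
  have hmem : ∀ᵐ t ∂volume.restrict (Set.Ioc 0 s), t ∈ Set.Ioc 0 s :=
    ae_restrict_mem measurableSet_Ioc
  rw [intervalIntegrable_iff_integrableOn_Ioc_of_le hs]
  refine Integrable.of_bound (aestronglyMeasurable_of_tendsto_ae atTop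
    (fun F : Finset (Σ n : ℕ, Fin n → σ) => (Finset.stronglyMeasurable_fun_sum F fun w _ =>
      P.stronglyMeasurable_op_term I w.2 S ψ).aestronglyMeasurable) ?_)
    _ (hmem.mono fun t ht => P.norm_op_total_le _ S ψ (Set.Ioc_subset_Icc_self ht))
  filter_upwards [hmem] with t ht
  exact P.hasSum_op_total _ S ψ ht.1.le

lemma hasSum_term_snoc (hs : 0 ≤ s) : HasSum
    (fun w : Σ n : ℕ, Fin n → σ => P.term I (Fin.snoc w.2 S : Fin (w.1 + 1) → σ) s ψ)
    (∫ t in 0..s, P.op S t (P.total (I \ P.hits I S t) t ψ)) := by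
  simp only [P.term_snoc I _ S hs]
  refine intervalIntegral.hasSum_integral_of_dominated_convergence
    (fun w _ => P.bound * ((P.bound * s) ^ w.1 / w.1.factorial * ‖ψ‖))
    (fun w => (P.stronglyMeasurable_op_term I w.2 S ψ).aestronglyMeasurable)
    (fun w => ae_of_all _ fun t ht => ?_)
    (ae_of_all _ fun t _ => (P.summable_norm_bound hs ψ).mul_left _)
    intervalIntegrable_const (ae_of_all _ fun t ht => ?_)
  all_goals rw [Set.uIoc_of_le hs] at ht
  · exact P.norm_op_term_le _ w.2 S (Set.Ioc_subset_Icc_self ht) ψ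
  · exact P.hasSum_op_total _ S ψ ht.1.le

end LastInsertion

end Total

section IntegralEquation

variable [CompleteSpace H] (I : Finset L) {s : ℝ}

lemma total_eq_add_integral [Fintype σ] [DecidableEq L] (hs : 0 ≤ s) (ψ : H) :
    P.total I s ψ = (if I = ∅ then ψ else 0) +
      ∫ t in 0..s, ∑ S, P.op S t (P.total (I \ P.hits I S t) t ψ) := by
  rw [intervalIntegral.integral_finsetSum fun S _ => P.intervalIntegrable_op_total I S ψ hs,
    ← P.term_elim0 I Fin.elim0 s ψ]
  exact (hasSum_words (f := fun w => P.term I w.2 s ψ) fun S => P.hasSum_term_snoc I S ψ hs).tsum_eq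

lemma total_zero [Finite σ] [DecidableEq L] (ψ : H) :
    P.total I 0 ψ = if I = ∅ then ψ else 0 := by
  have := Fintype.ofFinite σ
  rw [P.total_eq_add_integral I le_rfl, intervalIntegral.integral_same, add_zero]

lemma total_eq_total_zero_add_integral [Fintype σ] [DecidableEq L] (hs : 0 ≤ s) (ψ : H) :
    P.total I s ψ = P.total I 0 ψ +
      ∫ t in 0..s, ∑ S, P.op S t (P.total (I \ P.hits I S t) t ψ) := by
  rw [total_zero, ← P.total_eq_add_integral I hs]

lemma intervalIntegrable_sum_op_total [Fintype σ] [DecidableEq L] (hs : 0 ≤ s) (ψ : H) :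
    IntervalIntegrable (fun t => ∑ S, P.op S t (P.total (I \ P.hits I S t) t ψ)) volume 0 s := by
  simpa only [Finset.sum_fn] using IntervalIntegrable.sum Finset.univ fun S _ =>
    P.intervalIntegrable_op_total I S ψ hs

lemma ae_hasDerivAt_total [Fintype σ] [DecidableEq L] (hs : 0 ≤ s) (ψ : H) :
    ∀ᵐ t, t ∈ Set.Ioo 0 s → HasDerivAt (fun t => P.total I t ψ)
      (∑ S, P.op S t (P.total (I \ P.hits I S t) t ψ)) t :=
  ae_hasDerivAt_of_eq_add_integral (P.intervalIntegrable_sum_op_total I hs ψ)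
    fun _ ht => P.total_eq_total_zero_add_integral I ht.1 ψ

lemma exists_lipschitzOnWith_total [Finite σ] (hs : 0 ≤ s) (ψ : H) :
    ∃ K, LipschitzOnWith K (fun t => P.total I t ψ) (Set.Icc 0 s) := by
  classical
  have := Fintype.ofFinite σ
  let K : ℝ := ∑ _S : σ, ∑' w : Σ n : ℕ, Fin n → σ,
    P.bound * ((P.bound * s) ^ w.1 / w.1.factorial * ‖ψ‖)
  refine ⟨K.toNNReal, lipschitzOnWith_of_eq_add_integral (P.intervalIntegrable_sum_op_total I hs ψ)
    (fun t ht => (norm_sum_le_of_le _ fun S _ => ?_).trans (Real.le_coe_toNNReal K))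
    fun t ht => P.total_eq_total_zero_add_integral I ht.1 ψ⟩
  exact P.norm_op_total_le _ S ψ ht

end IntegralEquation

end Perturbation

lemma re_inner_apply_self_of_mem_skewAdjoint {H : Type*} [NormedAddCommGroup H]
    [InnerProductSpace ℂ H] [CompleteSpace H] {A : H →L[ℂ] H}
    (hA : A ∈ skewAdjoint (H →L[ℂ] H)) (ψ : H) : (inner ℂ ψ (A ψ)).re = 0 := by
  have hneg : inner ℂ (A ψ) ψ = -inner ℂ ψ (A ψ) := by
    rw [← ContinuousLinearMap.adjoint_inner_right, ← ContinuousLinearMap.star_eq_adjoint,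
      skewAdjoint.mem_iff.1 hA, neg_apply, inner_neg_right]
  have hre := congrArg Complex.re hneg
  rw [← inner_conj_symm, Complex.conj_re, Complex.neg_re] at hre
  linarith

lemma pow_mul_prod_sdiff_le_prod_erase {L : Type*} [DecidableEq L] {I K : Finset L} {l : L}
    (hK : K ⊆ I) (hl : l ∈ K) {δ : ℝ} (hδ : 0 ≤ δ) {h : L → ℝ} (hh : ∀ j, δ ≤ h j) :
    δ ^ (K.card - 1) * ∏ j ∈ I \ K, h j ≤ ∏ j ∈ I.erase l, h j := by
  have hsdiff : I.erase l \ K.erase l = I \ K := by grind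
  rw [← Finset.card_erase_of_mem hl, ← Finset.prod_sdiff (Finset.erase_subset_erase l hK), hsdiff,
    mul_comm]
  exact mul_le_mul_of_nonneg_left
    (Finset.prod_const δ ▸ Finset.prod_le_prod (fun _ _ => hδ) fun j _ => hh j)
    (Finset.prod_nonneg fun j _ => hδ.trans (hh j))

namespace Perturbation

variable {σ L H : Type*} [NormedAddCommGroup H] [InnerProductSpace ℂ H] [CompleteSpace H]
  {P : Perturbation σ L H} {I : Finset L} {δ : ℝ} {ψ : H}

lemma re_inner_op_total_le [DecidableEq L] {S : σ} {t g : ℝ} {h : L → ℝ}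
    (hskew : P.op S t ∈ skewAdjoint (H →L[ℂ] H)) (hδ : 0 < δ) (hh : ∀ l, δ ≤ h l)
    (hg : 1 ≤ g * δ ^ ((P.hits I S t).card - 1))
    (ih : ∀ J ⊂ I, ‖P.total J t ψ‖ ≤ (∏ l ∈ J, h l) * ‖ψ‖) :
    (inner ℂ (P.total I t ψ) (P.op S t (P.total (I \ P.hits I S t) t ψ))).re ≤
      ‖P.total I t ψ‖ *
        ∑ l ∈ P.hits I S t, (∏ j ∈ I.erase l, h j) * (‖P.op S t‖ * g) * ‖ψ‖ := by
  have hg0 : 0 ≤ g := (pos_of_mul_pos_left (zero_lt_one.trans_le hg) (by positivity)).le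
  have hprod : ∀ J : Finset L, 0 ≤ ∏ j ∈ J, h j :=
    fun J => Finset.prod_nonneg fun j _ => hδ.le.trans (hh j)
  obtain hempty | ⟨l, hl⟩ := (P.hits I S t).eq_empty_or_nonempty
  · rw [hempty, Finset.sdiff_empty, re_inner_apply_self_of_mem_skewAdjoint hskew,
      Finset.sum_empty, mul_zero]
  have hhits : ∏ j ∈ I \ P.hits I S t, h j ≤ g * ∏ j ∈ I.erase l, h j :=
    calc ∏ j ∈ I \ P.hits I S t, h j
        ≤ g * δ ^ ((P.hits I S t).card - 1) * ∏ j ∈ I \ P.hits I S t, h j :=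
          le_mul_of_one_le_left (hprod _) hg
      _ ≤ g * ∏ j ∈ I.erase l, h j := by
          rw [mul_assoc]
          exact mul_le_mul_of_nonneg_left
            (pow_mul_prod_sdiff_le_prod_erase (P.hits_subset I S t) hl hδ.le hh) hg0
  refine (Complex.re_le_norm _).trans ((norm_inner_le_norm _ _).trans
    (mul_le_mul_of_nonneg_left ?_ (norm_nonneg _)))
  calc ‖P.op S t (P.total (I \ P.hits I S t) t ψ)‖
      ≤ ‖P.op S t‖ * ((∏ j ∈ I \ P.hits I S t, h j) * ‖ψ‖) :=
        ContinuousLinearMap.le_opNorm_of_le _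
          (ih _ (Finset.sdiff_ssubset (P.hits_subset I S t) ⟨l, hl⟩))
    _ ≤ ‖P.op S t‖ * ((g * ∏ j ∈ I.erase l, h j) * ‖ψ‖) := by gcongr
    _ = (∏ j ∈ I.erase l, h j) * (‖P.op S t‖ * g) * ‖ψ‖ := by ring
    _ ≤ ∑ l ∈ P.hits I S t, (∏ j ∈ I.erase l, h j) * (‖P.op S t‖ * g) * ‖ψ‖ :=
        Finset.single_le_sum (f := fun l => (∏ j ∈ I.erase l, h j) * (‖P.op S t‖ * g) * ‖ψ‖)
          (fun l _ => mul_nonneg (mul_nonneg (hprod _) (by positivity)) (norm_nonneg _)) hl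

variable [Fintype σ] {g : σ → ℝ} {r : L → ℝ → ℝ} {T : ℝ}

lemma sum_re_inner_op_total_le [DecidableEq L] {t : ℝ} {h : L → ℝ}
    (hskew : ∀ S, P.op S t ∈ skewAdjoint (H →L[ℂ] H)) (hδ : 0 < δ) (hh : ∀ l, δ ≤ h l)
    (hg : ∀ S, 1 ≤ g S * δ ^ ((P.hits I S t).card - 1))
    (ih : ∀ J ⊂ I, ‖P.total J t ψ‖ ≤ (∏ l ∈ J, h l) * ‖ψ‖) :
    (inner ℂ (P.total I t ψ) (∑ S, P.op S t (P.total (I \ P.hits I S t) t ψ))).re ≤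
      ‖P.total I t ψ‖ * ((∑ l ∈ I, (∏ j ∈ I.erase l, h j) * P.hitRate g l t) * ‖ψ‖) := by
  have hswap : (∑ l ∈ I, (∏ j ∈ I.erase l, h j) * P.hitRate g l t) * ‖ψ‖ =
      ∑ S, ∑ l ∈ P.hits I S t, (∏ j ∈ I.erase l, h j) * (‖P.op S t‖ * g S) * ‖ψ‖ := by
    simp only [hitRate, Finset.mul_sum, Finset.sum_mul]
    refine Finset.sum_comm' fun l S => ?_
    simp [mem_hits]
  rw [hswap, inner_sum, Complex.re_sum, Finset.mul_sum]
  exact Finset.sum_le_sum fun S _ => re_inner_op_total_le (hskew S) hδ hh (hg S) ih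

lemma norm_total_le_prod_of_ssubset (hT : 0 ≤ T) (hδ : 0 < δ)
    (hskew : ∀ S t, P.op S t ∈ skewAdjoint (H →L[ℂ] H))
    (hg : ∀ S t, 1 ≤ g S * δ ^ ((P.hits I S t).card - 1))
    (hr : ∀ l, IntervalIntegrable (r l) volume 0 T)
    (hr0 : ∀ l, ∀ t ∈ Set.Icc 0 T, 0 ≤ r l t)
    (hPr : ∀ l, ∀ t ∈ Set.Icc 0 T, P.hitRate g l t ≤ r l t)
    (ih : ∀ J ⊂ I, ∀ t ∈ Set.Icc 0 T,
      ‖P.total J t ψ‖ ≤ (∏ l ∈ J, (δ + ∫ τ in 0..t, r l τ)) * ‖ψ‖) :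
    ‖P.total I T ψ‖ ≤ (∏ l ∈ I, (δ + ∫ τ in 0..T, r l τ)) * ‖ψ‖ := by
  classical
  let _ := InnerProductSpace.complexToReal (G := H)
  have hh : ∀ t ∈ Set.Icc 0 T, ∀ l, δ ≤ δ + ∫ τ in 0..t, r l τ := fun t ht l =>
    le_add_of_nonneg_right (intervalIntegral.integral_nonneg ht.1 fun τ hτ =>
      hr0 l τ ⟨hτ.1, hτ.2.trans ht.2⟩)
  have hprod : ∀ t ∈ Set.Icc 0 T, ∀ J : Finset L, 0 ≤ ∏ l ∈ J, (δ + ∫ τ in 0..t, r l τ) :=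
    fun t ht J => Finset.prod_nonneg fun l _ => hδ.le.trans (hh t ht l)
  obtain ⟨K, hK⟩ := P.exists_lipschitzOnWith_total I hT ψ
  refine norm_le_of_ae_inner_le hT hK (P.ae_hasDerivAt_total I hT ψ)
    (R := fun t => (∏ l ∈ I, (δ + ∫ τ in 0..t, r l τ)) * ‖ψ‖)
    (R' := fun t => (∑ l ∈ I, (∏ j ∈ I.erase l, (δ + ∫ τ in 0..t, r j τ)) * r l t) * ‖ψ‖)
    ?_ ?_ (fun t ht => ?_) (fun t ht => ?_) ?_
  · exact (absolutelyContinuousOnInterval_prod_add_integral hr I).fun_mul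
      (LipschitzWith.const ‖ψ‖).lipschitzOnWith.absolutelyContinuousOnInterval
  · filter_upwards [ae_hasDerivAt_prod_add_integral hr I] with t ht hmem
    exact (ht hmem).mul_const ‖ψ‖
  · have ht' := Set.Ioo_subset_Icc_self ht
    exact mul_nonneg (Finset.sum_nonneg fun l _ => mul_nonneg (hprod t ht' _) (hr0 l t ht'))
      (norm_nonneg _)
  · have ht' := Set.Ioo_subset_Icc_self ht
    refine (sum_re_inner_op_total_le (hskew · t) hδ (hh t ht') (hg · t) (ih · · t ht')).trans ?_
    gcongr with l
    · exact hprod t ht' _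
    · exact hPr l t ht'
  · rw [total_zero]
    split_ifs with hI
    · simp [hI]
    · rw [norm_zero]
      exact mul_nonneg (hprod 0 (Set.left_mem_Icc.2 hT) I) (norm_nonneg _)

theorem norm_total_le_prod (hT : 0 ≤ T) (hδ : 0 < δ)
    (hskew : ∀ S t, P.op S t ∈ skewAdjoint (H →L[ℂ] H))
    (hg : ∀ I S t, 1 ≤ g S * δ ^ ((P.hits I S t).card - 1))
    (hr : ∀ l, IntervalIntegrable (r l) volume 0 T)
    (hPr : ∀ l, ∀ t ∈ Set.Icc 0 T, P.hitRate g l t ≤ r l t) :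
    ‖P.total I T ψ‖ ≤ (∏ l ∈ I, (δ + ∫ τ in 0..T, r l τ)) * ‖ψ‖ := by
  induction I using Finset.strongInduction generalizing T with
  | H I ih =>
    have hr0 : ∀ l, ∀ t ∈ Set.Icc 0 T, 0 ≤ r l t := fun l t ht =>
      (P.hitRate_nonneg (P.one_le_weight hg) l t).trans (hPr l t ht)
    refine norm_total_le_prod_of_ssubset hT hδ hskew (hg I) hr hr0 hPr fun J hJ t ht => ?_
    have hsub : Set.Icc 0 t ⊆ Set.Icc 0 T := Set.Icc_subset_Icc_right ht.2
    refine ih J hJ ht.1 (fun l => (hr l).mono_set ?_) fun l τ hτ => hPr l τ (hsub hτ)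
    rwa [Set.uIcc_of_le ht.1, Set.uIcc_of_le hT]

theorem norm_totalCLM_le_pow {c : ℝ} (hT : 0 ≤ T) (hδ : 0 < δ)
    (hskew : ∀ S t, P.op S t ∈ skewAdjoint (H →L[ℂ] H))
    (hg : ∀ I S t, 1 ≤ g S * δ ^ ((P.hits I S t).card - 1))
    (hr : ∀ l, IntervalIntegrable (r l) volume 0 T)
    (hPr : ∀ l, ∀ t ∈ Set.Icc 0 T, P.hitRate g l t ≤ r l t)
    (hc : ∀ l, ∫ t in 0..T, r l t ≤ c) : ‖P.totalCLM I hT‖ ≤ (δ + c) ^ I.card := by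
  have hr0 : ∀ l, 0 ≤ ∫ t in 0..T, r l t := fun l =>
    intervalIntegral.integral_nonneg hT fun t ht =>
      (P.hitRate_nonneg (P.one_le_weight hg) l t).trans (hPr l t ht)
  have hprod : ∏ l ∈ I, (δ + ∫ t in 0..T, r l t) ≤ (δ + c) ^ I.card :=
    Finset.prod_const (δ + c) ▸ Finset.prod_le_prod (fun l _ => add_nonneg hδ.le (hr0 l))
      fun l _ => by gcongr; exact hc l
  refine ContinuousLinearMap.opNorm_le_bound _ ?_ fun ψ => ?_
  · exact (Finset.prod_nonneg fun l _ => add_nonneg hδ.le (hr0 l)).trans hprod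
  · exact (norm_total_le_prod hT hδ hskew hg hr hPr).trans (by gcongr)

end Perturbation

lemma continuous_adjoint_apply {X H : Type*} [TopologicalSpace X] [NormedAddCommGroup H]
    [InnerProductSpace ℂ H] [CompleteSpace H] {U : X → H →L[ℂ] H}
    (hU : ∀ x, U x ∈ unitary (H →L[ℂ] H)) (hc : ∀ ψ, Continuous fun x => U x ψ) (ψ : H) :
    Continuous fun x => ContinuousLinearMap.adjoint (U x) ψ := by
  have happly : ∀ x, U x (ContinuousLinearMap.adjoint (U x) ψ) = ψ := fun x =>
    congrArg (fun A : H →L[ℂ] H => A ψ) (Unitary.mul_star_self_of_mem (hU x))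
  refine continuous_iff_continuousAt.2 fun x₀ => tendsto_iff_norm_sub_tendsto_zero.2 ?_
  set φ := ContinuousLinearMap.adjoint (U x₀) ψ with hφ
  have hdist : ∀ x, ‖ContinuousLinearMap.adjoint (U x) ψ - φ‖ = ‖U x φ - U x₀ φ‖ := fun x => by
    rw [← ContinuousLinearMap.norm_map_of_mem_unitary (hU x), map_sub, happly x, hφ, happly x₀,
      norm_sub_rev]
  exact (tendsto_iff_norm_sub_tendsto_zero.1 ((hc φ).tendsto x₀)).congr fun x => (hdist x).symm

namespace Noise

variable {Q L B : Type*} [Fintype Q] [DecidableEq Q] [NormedAddCommGroup B]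
  [InnerProductSpace ℂ B] [CompleteSpace B] (N : Noise Q B)

lemma exists_norm_coupling_le : ∃ K : NNReal, ∀ S t, ‖N.coupling S t‖ ≤ K := by
  choose K hK using N.coupling_bounded
  exact ⟨∑ S, (K S).toNNReal, fun S t => (hK S t).trans ((Real.le_coe_toNNReal _).trans
    (NNReal.coe_le_coe.2 (Finset.single_le_sum (f := fun S => (K S).toNNReal)
      (fun _ _ => bot_le) (Finset.mem_univ S))))⟩

variable {U₀ : ℝ → JointOp Q B}

lemma norm_neg_I_smul_interactionPicture (hU : ∀ t, U₀ t ∈ unitary (JointOp Q B)) (S : Finset Q)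
    (t : ℝ) : ‖(-Complex.I) • interactionPicture N U₀ S t‖ = ‖N.coupling S t‖ := by
  rw [norm_smul, norm_neg, Complex.norm_I, one_mul, interactionPicture,
    ← ContinuousLinearMap.star_eq_adjoint, CStarRing.norm_mul_mem_unitary _ (hU t),
    CStarRing.norm_mem_unitary_mul _ (Unitary.star_mem (hU t))]

lemma neg_I_smul_interactionPicture_mem_skewAdjoint (S : Finset Q) (t : ℝ) :
    (-Complex.I) • interactionPicture N U₀ S t ∈ skewAdjoint (JointOp Q B) :=
  ((N.coupling_selfAdjoint S t).conjugate' (U₀ t)).smul_mem_skewAdjoint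
    (neg_mem Complex.I_mem_skewAdjoint)

lemma stronglyMeasurable_interactionPicture (hU : ∀ t, U₀ t ∈ unitary (JointOp Q B))
    (hc : ∀ ψ, Continuous fun t => U₀ t ψ) (S : Finset Q) (ψ : JointSpace Q B) :
    StronglyMeasurable fun t => interactionPicture N U₀ S t ψ :=
  stronglyMeasurable_clm_apply (A := fun t => ContinuousLinearMap.adjoint (U₀ t))
    (fun φ => (continuous_adjoint_apply hU hc φ).stronglyMeasurable)
    (stronglyMeasurable_clm_apply
      (fun φ => (ContinuousLinearMap.apply ℂ _ φ).continuous.comp_stronglyMeasurable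
        (N.coupling_measurable S))
      (hc ψ).stronglyMeasurable)

/-- The terms `-i H_S` of the perturbation in the interaction picture; an insertion hits the
locations that it makes faulty. -/
def perturbation (C : Circuit Q L) (hU : ∀ t, U₀ t ∈ unitary (JointOp Q B))
    (hc : ∀ ψ, Continuous fun t => U₀ t ψ) :
    Perturbation {S : Finset Q // S.Nonempty} L (JointSpace Q B) where
  op S t := (-Complex.I) • interactionPicture N U₀ S t
  hit S t l := t ∈ C.window l ∧ ((S : Finset Q) ∩ C.qubits l).Nonempty
  bound := N.exists_norm_coupling_le.choose
  stronglyMeasurable_op S ψ :=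
    (N.stronglyMeasurable_interactionPicture hU hc S ψ).const_smul (-Complex.I)
  norm_op_le S t := (N.norm_neg_I_smul_interactionPicture hU S t).trans_le
    (N.exists_norm_coupling_le.choose_spec S t)
  measurableSet_hit _ _ := measurableSet_Ico.inter (.const _)

variable (C : Circuit Q L) (hU : ∀ t, U₀ t ∈ unitary (JointOp Q B))
  (hc : ∀ ψ, Continuous fun t => U₀ t ψ)

lemma dysonIntegrand_apply (w : Word Q) (t : Fin w.1 → ℝ) (ψ : JointSpace Q B) :
    dysonIntegrand C N U₀ w t ψ = U₀ C.T ((N.perturbation C hU hc).integrand w.2 t ψ) := by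
  have hsmul := (List.ofFn fun j => interactionPicture N U₀ (w.2 j) (t j)).reverse.smul_prod
    (-Complex.I)
  rw [List.map_reverse, List.map_ofFn, List.length_reverse, List.length_ofFn] at hsmul
  rw [dysonIntegrand, ← mul_smul_comm, hsmul]
  rfl

lemma faultyTimes_ae_eq (I : Finset L) (w : Word Q) :
    faultyTimes C I w =ᵐ[volume] (N.perturbation C hU hc).times I w.2 C.T := by
  have hne : ∀ᵐ t : Fin w.1 → ℝ, ∀ j, t j ≠ C.T :=
    ae_all_iff.2 fun j => Measure.ae_eval_ne (α := fun _ => ℝ) (fun _ => volume) j C.T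
  filter_upwards [hne] with t ht
  refine propext (and_congr_right fun _ => and_congr_left fun _ => forall_congr' fun j => ?_)
  exact and_congr_right fun _ => ⟨fun hle => hle.lt_of_ne (ht j), le_of_lt⟩

lemma isFaultSum (I : Finset L) :
    IsFaultSum C N U₀ I (U₀ C.T * (N.perturbation C hU hc).totalCLM I C.T_nonneg) := fun ψ => by
  set P := N.perturbation C hU hc
  have hint : ∀ w : Word Q, IntegrableOn (fun t => P.integrand w.2 t ψ) (faultyTimes C I w) :=
    fun w => (P.integrableOn_integrand w.2 I C.T ψ).congr_set_ae (N.faultyTimes_ae_eq C hU hc I w)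
  have hterm : ∀ w : Word Q, ∫ t in faultyTimes C I w, U₀ C.T (P.integrand w.2 t ψ) =
      U₀ C.T (P.term I w.2 C.T ψ) := fun w => by
    rw [(U₀ C.T).integral_comp_comm (hint w),
      setIntegral_congr_set (N.faultyTimes_ae_eq C hU hc I w), Perturbation.term]
  simp only [N.dysonIntegrand_apply C hU hc]
  exact ⟨fun w => (U₀ C.T).integrable_comp (hint w), HasSum.congr_fun
    ((U₀ C.T).hasSum (P.summable_term I C.T_nonneg ψ).hasSum) hterm⟩

lemma card_hits_le (I : Finset L) (S : {S : Finset Q // S.Nonempty}) (t : ℝ) :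
    ((N.perturbation C hU hc).hits I S t).card ≤ S.1.card := by
  have : Nonempty Q := S.2.nonempty
  have hhit : ∀ l, l ∈ (N.perturbation C hU hc).hits I S t →
      t ∈ C.window l ∧ ∃ q, q ∈ S.1 ∧ q ∈ C.qubits l := fun l hl =>
    have ⟨hwindow, q, hq⟩ := ((Perturbation.mem_hits _).1 hl).2
    ⟨hwindow, q, Finset.mem_inter.1 hq⟩
  choose! hwindow q hqS hql using hhit
  refine Finset.card_le_card_of_injOn q hqS fun l hl l' hl' heq => by_contra fun hne => ?_
  exact Set.disjoint_left.1 (C.disjoint l l' hne (q l) (hql l hl) (heq ▸ hql l' hl'))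
    (hwindow l hl) (hwindow l' hl')

end Noise

lemma factorial_le_card_image_cons_eq {Q : Type*} [Fintype Q] [DecidableEq Q] {n : ℕ} {i : Q}
    {S : Finset Q} (hi : i ∈ S) (hS : S.card = n + 1) :
    n.factorial ≤ ({f : Fin n → Q |
      Finset.univ.image (Fin.cons i f : Fin (n + 1) → Q) = S} : Finset (Fin n → Q)).card := by
  have hcard : Fintype.card (S.erase i) = n := by
    rw [Fintype.card_coe, Finset.card_erase_of_mem hi, hS, Nat.add_sub_cancel]
  have hperm : (Finset.univ : Finset (Fin n ≃ S.erase i)).card = n.factorial := by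
    rw [Finset.card_univ, Fintype.card_equiv (Fintype.equivFinOfCardEq hcard).symm,
      Fintype.card_fin]
  rw [← hperm]
  refine Finset.card_le_card_of_injOn (fun e j => (e j : Q)) (fun e _ => ?_)
    fun e _ e' _ h => Equiv.ext fun j => Subtype.ext (congrFun h j)
  have hrange : Set.range (fun j => (e j : Q)) = S.erase i := by
    rw [← Subtype.range_coe (s := (S.erase i : Set Q)), ← e.surjective.range_comp]
    rfl
  refine Finset.mem_coe.2 (Finset.mem_filter.2 ⟨Finset.mem_univ _, Finset.coe_injective ?_⟩)
  rw [Finset.coe_image, Finset.coe_univ, Set.image_univ, Fin.range_cons, hrange,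
    ← Finset.coe_insert, Finset.insert_erase hi]

lemma sum_filter_inter_nonempty_le {Q : Type*} [Fintype Q] [DecidableEq Q] (A : Finset Q)
    {F : Finset Q → ℝ} (hF : ∀ S, 0 ≤ F S) :
    ∑ S with (S ∩ A).Nonempty, F S ≤ ∑ i ∈ A, ∑ S with i ∈ S, F S := by
  simp only [Finset.sum_filter]
  rw [Finset.sum_comm]
  refine Finset.sum_le_sum fun S _ => ?_
  have hnonneg : ∀ i ∈ A, 0 ≤ if i ∈ S then F S else 0 := fun i _ => by
    split_ifs <;> simp [hF]
  split_ifs with h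
  · obtain ⟨i, hi⟩ := h
    obtain ⟨hiS, hiA⟩ := Finset.mem_inter.1 hi
    simpa only [if_pos hiS] using Finset.single_le_sum hnonneg hiA
  · exact Finset.sum_nonneg hnonneg

namespace Circuit

variable {Q L : Type*} (C : Circuit Q L)

lemma maxDuration_nonneg : 0 ≤ C.maxDuration :=
  Real.iSup_nonneg fun l => sub_nonneg.2 (C.start_le_finish l)

lemma duration_le_maxDuration (l : L) : C.finish l - C.start l ≤ C.maxDuration := by
  refine le_ciSup (f := fun l => C.finish l - C.start l) ⟨C.T, ?_⟩ l
  rintro _ ⟨l, rfl⟩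
  linarith [C.start_nonneg l, C.finish_le l]

lemma measurableSet_window (l : L) : MeasurableSet (C.window l) := measurableSet_Ico

lemma intervalIntegral_indicator_window_le {c : ℝ} (hc : 0 ≤ c) (l : L) :
    ∫ t in 0..C.T, (C.window l).indicator (fun _ => c / C.maxDuration) t ≤ c := by
  have hvol : (volume.restrict (Set.Ioc 0 C.T)).real (C.window l) ≤ C.maxDuration := by
    refine le_trans ?_ (C.duration_le_maxDuration l)
    rw [← Real.volume_real_Ico_of_le (C.start_le_finish l)]
    exact ENNReal.toReal_mono measure_Ico_lt_top.ne (Measure.restrict_apply_le _ _)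
  rw [intervalIntegral.integral_of_le C.T_nonneg,
    integral_indicator_const _ (C.measurableSet_window l), smul_eq_mul]
  calc (volume.restrict (Set.Ioc 0 C.T)).real (C.window l) * (c / C.maxDuration)
      ≤ C.maxDuration * (c / C.maxDuration) :=
        mul_le_mul_of_nonneg_right hvol (div_nonneg hc C.maxDuration_nonneg)
    _ ≤ c := by
        rw [mul_div_left_comm]
        exact mul_le_of_le_one_right hc (div_self_le_one _)

end Circuit

section CouplingStrength

variable {Q L B : Type*} [Fintype Q] [DecidableEq Q] [NormedAddCommGroup B]
  [InnerProductSpace ℂ B] [CompleteSpace B] (C : Circuit Q L) (N : Noise Q B)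

lemma le_couplingStrength (n : ℕ) (i : Q) {t : ℝ} (ht : t ∈ Set.Icc 0 C.T) :
    (∑ f : Fin n → Q, ‖tupleCoupling N (Fin.cons i f : Fin (n + 1) → Q) t‖) * C.maxDuration ≤
      couplingStrength C N n := by
  obtain ⟨K, hK⟩ := N.exists_norm_coupling_le
  refine le_ciSup (f := fun p : Q × Set.Icc (0 : ℝ) C.T => (∑ f : Fin n → Q,
    ‖tupleCoupling N (Fin.cons p.1 f : Fin (n + 1) → Q) p.2‖) * C.maxDuration) ?_ (i, ⟨t, ht⟩)
  refine ⟨(∑ _f : Fin n → Q, (K : ℝ)) * C.maxDuration, ?_⟩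
  rintro _ ⟨p, rfl⟩
  refine mul_le_mul_of_nonneg_right (Finset.sum_le_sum fun f _ => ?_) C.maxDuration_nonneg
  unfold tupleCoupling
  split_ifs
  · exact hK _ _
  · exact norm_zero.trans_le K.coe_nonneg

lemma couplingStrength_nonneg (n : ℕ) : 0 ≤ couplingStrength C N n :=
  Real.iSup_nonneg fun _ => mul_nonneg (Finset.sum_nonneg fun _ _ => norm_nonneg _)
    C.maxDuration_nonneg

lemma couplingStrength_eq_zero {n : ℕ} (hn : Fintype.card Q ≤ n) : couplingStrength C N n = 0 := by
  have hinj : ∀ i : Fin (n + 1) → Q, ¬ Function.Injective i := fun i hi => by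
    have hcard := Fintype.card_le_of_injective i hi
    rw [Fintype.card_fin] at hcard
    lia
  simp [couplingStrength, tupleCoupling, hinj]

lemma alpha_nonneg : 0 ≤ alpha C N :=
  Real.iSup_nonneg fun n => Real.rpow_nonneg (couplingStrength_nonneg C N n) _

lemma couplingStrength_le_alpha_pow (n : ℕ) : couplingStrength C N n ≤ alpha C N ^ (n + 1) := by
  have hbdd : BddAbove (Set.range fun n : ℕ => couplingStrength C N n ^ (1 / ((n : ℝ) + 1))) := by
    refine Tendsto.bddAbove_range (tendsto_atTop_of_eventually_const (x := 0)
      (i₀ := Fintype.card Q) fun n hn => ?_)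
    rw [couplingStrength_eq_zero C N hn, Real.zero_rpow (by positivity)]
  have hle : couplingStrength C N n ^ (1 / ((n : ℝ) + 1)) ≤ alpha C N := le_ciSup hbdd n
  rw [one_div, Real.rpow_inv_le_iff_of_pos (couplingStrength_nonneg C N n) (alpha_nonneg C N)
    (by positivity)] at hle
  exact_mod_cast hle

lemma tupleCoupling_of_image_eq {k : ℕ} {i : Fin k → Q} {S : Finset Q}
    (hi : Finset.univ.image i = S) (hS : S.card = k) (t : ℝ) :
    tupleCoupling N i t = N.coupling S t := by
  have hinj : Function.Injective i := by
    rw [← Set.injOn_univ, ← Finset.coe_univ, ← Finset.card_image_iff, hi, hS, Finset.card_fin]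
  rw [tupleCoupling, if_pos hinj, hi]

lemma factorial_mul_sum_le_sum_tupleCoupling (n : ℕ) (i : Q) (t : ℝ) :
    n.factorial * ∑ S with i ∈ S ∧ S.card = n + 1, ‖N.coupling S t‖ ≤
      ∑ f : Fin n → Q, ‖tupleCoupling N (Fin.cons i f : Fin (n + 1) → Q) t‖ := by
  rw [Finset.mul_sum]
  refine (Finset.sum_le_sum fun S hS => ?_).trans (Finset.sum_fiberwise_le_sum_of_sum_fiber_nonneg
    (g := fun f : Fin n → Q => Finset.univ.image (Fin.cons i f : Fin (n + 1) → Q))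
    fun S _ => Finset.sum_nonneg fun f _ => norm_nonneg _)
  obtain ⟨-, hi, hcard⟩ := Finset.mem_filter.1 hS
  rw [Finset.sum_congr rfl fun f hf => congrArg norm
    (tupleCoupling_of_image_eq N (Finset.mem_filter.1 hf).2 hcard t), Finset.sum_const,
    nsmul_eq_mul]
  gcongr
  exact factorial_le_card_image_cons_eq hi hcard

lemma sum_coupling_mul_maxDuration_le (n : ℕ) (i : Q) {t : ℝ} (ht : t ∈ Set.Icc 0 C.T) :
    (∑ S with i ∈ S ∧ S.card = n + 1, ‖N.coupling S t‖) * C.maxDuration ≤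
      alpha C N ^ (n + 1) / n.factorial := by
  rw [le_div_iff₀' (by positivity), ← mul_assoc]
  exact (mul_le_mul_of_nonneg_right (factorial_mul_sum_le_sum_tupleCoupling N n i t)
    C.maxDuration_nonneg).trans
      ((le_couplingStrength C N n i ht).trans (couplingStrength_le_alpha_pow C N n))

lemma sum_coupling_mul_pow_mul_maxDuration_le {ρ : ℝ} (hρ : 0 ≤ ρ) (i : Q) {t : ℝ}
    (ht : t ∈ Set.Icc 0 C.T) :
    (∑ S with i ∈ S, ‖N.coupling S t‖ * ρ ^ (S.card - 1)) * C.maxDuration ≤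
      alpha C N * Real.exp (alpha C N * ρ) := by
  have hα := alpha_nonneg C N
  have hmaps : ∀ S ∈ ({S | i ∈ S} : Finset (Finset Q)),
      S.card - 1 ∈ Finset.range (Fintype.card Q) := fun S hS => by
    have hpos := Finset.card_pos.2 ⟨i, (Finset.mem_filter.1 hS).2⟩
    have hle := S.card_le_univ
    rw [Finset.mem_range]
    lia
  have hfiber : ∀ n, ∑ S ∈ ({S | i ∈ S} : Finset (Finset Q)) with S.card - 1 = n,
      ‖N.coupling S t‖ * ρ ^ (S.card - 1) =
        (∑ S with i ∈ S ∧ S.card = n + 1, ‖N.coupling S t‖) * ρ ^ n := fun n => by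
    rw [Finset.sum_mul, Finset.filter_filter]
    refine Finset.sum_congr (Finset.filter_congr fun S _ => and_congr_right fun hi => ?_)
      fun S hS => ?_
    · have hpos := Finset.card_pos.2 ⟨i, hi⟩
      lia
    · rw [(Finset.mem_filter.1 hS).2.2, Nat.add_sub_cancel]
  rw [← Finset.sum_fiberwise_of_maps_to hmaps, Finset.sum_mul]
  calc ∑ n ∈ Finset.range (Fintype.card Q),
        (∑ S ∈ ({S | i ∈ S} : Finset (Finset Q)) with S.card - 1 = n,
          ‖N.coupling S t‖ * ρ ^ (S.card - 1)) * C.maxDuration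
      ≤ ∑ n ∈ Finset.range (Fintype.card Q), alpha C N ^ (n + 1) / n.factorial * ρ ^ n := by
        refine Finset.sum_le_sum fun n _ => ?_
        rw [hfiber, mul_right_comm]
        gcongr
        exact sum_coupling_mul_maxDuration_le C N n i ht
    _ = alpha C N * ∑ n ∈ Finset.range (Fintype.card Q), (alpha C N * ρ) ^ n / n.factorial := by
        rw [Finset.mul_sum]
        exact Finset.sum_congr rfl fun n _ => by ring
    _ ≤ alpha C N * Real.exp (alpha C N * ρ) :=
        mul_le_mul_of_nonneg_left (Real.sum_le_exp_of_nonneg (by positivity) _) hα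

end CouplingStrength

namespace Noise

variable {Q L B : Type*} [Fintype Q] [DecidableEq Q] [NormedAddCommGroup B]
  [InnerProductSpace ℂ B] [CompleteSpace B] (N : Noise Q B) (C : Circuit Q L)
  {U₀ : ℝ → JointOp Q B} (hU : ∀ t, U₀ t ∈ unitary (JointOp Q B))
  (hc : ∀ ψ, Continuous fun t => U₀ t ψ)

lemma hitRate_perturbation (ρ : ℝ) (l : L) (t : ℝ) :
    (N.perturbation C hU hc).hitRate (fun S => ρ ^ (S.1.card - 1)) l t =
      (C.window l).indicator (fun t => ∑ S with (S ∩ C.qubits l).Nonempty,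
        ‖N.coupling S t‖ * ρ ^ (S.card - 1)) t := by
  classical
  by_cases ht : t ∈ C.window l
  · rw [Set.indicator_of_mem ht]
    refine Finset.sum_nbij Subtype.val (fun S hS => ?_) Subtype.val_injective.injOn
      (fun S hS => ?_) fun S _ => ?_
    · exact Finset.mem_filter.2 ⟨Finset.mem_univ _, (Finset.mem_filter.1 hS).2.2⟩
    · have hmem := (Finset.mem_filter.1 hS).2
      exact ⟨⟨S, hmem.mono Finset.inter_subset_left⟩,
        Finset.mem_filter.2 ⟨Finset.mem_univ _, ht, hmem⟩, rfl⟩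
    · exact congrArg (· * _) (N.norm_neg_I_smul_interactionPicture hU S t)
  · rw [Set.indicator_of_notMem ht]
    exact Finset.sum_eq_zero fun S hS => absurd (Finset.mem_filter.1 hS).2.1 ht

lemma hitRate_perturbation_le {ρ : ℝ} (hρ : 0 ≤ ρ) {m : ℕ} {l : L} (hm : (C.qubits l).card ≤ m)
    {t : ℝ} (ht : t ∈ Set.Icc 0 C.T) :
    (N.perturbation C hU hc).hitRate (fun S => ρ ^ (S.1.card - 1)) l t ≤
      (C.window l).indicator
        (fun _ => m * (alpha C N * Real.exp (alpha C N * ρ)) / C.maxDuration) t := by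
  rw [hitRate_perturbation]
  refine Set.indicator_le_indicator' fun hw => ?_
  have hdur : 0 < C.maxDuration :=
    (sub_pos.2 (hw.1.trans_lt hw.2)).trans_le (C.duration_le_maxDuration l)
  have hα := alpha_nonneg C N
  rw [le_div_iff₀ hdur]
  calc (∑ S with (S ∩ C.qubits l).Nonempty, ‖N.coupling S t‖ * ρ ^ (S.card - 1)) * C.maxDuration
      ≤ (∑ i ∈ C.qubits l, ∑ S with i ∈ S, ‖N.coupling S t‖ * ρ ^ (S.card - 1)) *
          C.maxDuration := by
        gcongr
        exact sum_filter_inter_nonempty_le _ fun S => by positivity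
    _ ≤ ∑ _i ∈ C.qubits l, alpha C N * Real.exp (alpha C N * ρ) := by
        rw [Finset.sum_mul]
        exact Finset.sum_le_sum fun i _ => sum_coupling_mul_pow_mul_maxDuration_le C N hρ i ht
    _ ≤ m * (alpha C N * Real.exp (alpha C N * ρ)) := by
        rw [Finset.sum_const, nsmul_eq_mul]
        gcongr

lemma norm_faultSum_le {δ ρ : ℝ} (hδ : 0 < δ) (hρ : 1 ≤ ρ) (hρδ : 1 ≤ ρ * δ) {m : ℕ}
    (hm : ∀ l, (C.qubits l).card ≤ m) (I : Finset L) :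
    ‖U₀ C.T * (N.perturbation C hU hc).totalCLM I C.T_nonneg‖ ≤
      (δ + m * (alpha C N * Real.exp (alpha C N * ρ))) ^ I.card := by
  classical
  have hα := alpha_nonneg C N
  have hρ0 : 0 ≤ ρ := zero_le_one.trans hρ
  rw [CStarRing.norm_mem_unitary_mul _ (hU C.T)]
  refine Perturbation.norm_totalCLM_le_pow C.T_nonneg hδ
    (fun S => N.neg_I_smul_interactionPicture_mem_skewAdjoint S)
    (g := fun S => ρ ^ (S.1.card - 1)) (fun I S t => ?_) (fun l => ?_)
    (fun l t ht => N.hitRate_perturbation_le C hU hc hρ0 (hm l) ht)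
    (C.intervalIntegral_indicator_window_le (by positivity))
  · calc 1 ≤ (ρ * δ) ^ (((N.perturbation C hU hc).hits I S t).card - 1) := one_le_pow₀ hρδ
      _ ≤ ρ ^ (S.1.card - 1) * δ ^ (((N.perturbation C hU hc).hits I S t).card - 1) := by
          rw [mul_pow]
          gcongr
          exact N.card_hits_le C hU hc I S t
  · exact ((integrable_indicator_iff (C.measurableSet_window l)).2
      (integrableOn_const measure_Ico_lt_top.ne)).intervalIntegrable

lemma norm_faultSum_le_pow (hα : alpha C N ≤ 1) {m : ℕ} (hm : ∀ l, (C.qubits l).card ≤ m)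
    (I : Finset L) : ‖U₀ C.T * (N.perturbation C hU hc).totalCLM I C.T_nonneg‖ ≤
      ((1 + Real.exp 1) * m * alpha C N) ^ I.card := by
  have hα0 := alpha_nonneg C N
  have hbound : ∀ δ ∈ Set.Ioi (m * alpha C N),
      ‖U₀ C.T * (N.perturbation C hU hc).totalCLM I C.T_nonneg‖ ≤
        (δ + m * (alpha C N * Real.exp 1)) ^ I.card := fun δ hδ => by
    have hδ0 : 0 < δ := lt_of_le_of_lt (by positivity) hδ
    refine (N.norm_faultSum_le C hU hc hδ0 (le_max_left 1 δ⁻¹) ?_ hm I).trans ?_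
    · exact (inv_mul_cancel₀ hδ0.ne').symm.trans_le (by gcongr; exact le_max_right _ _)
    · obtain rfl | hm1 := m.eq_zero_or_pos
      · simp
      · have hαδ : alpha C N ≤ δ :=
          (le_mul_of_one_le_left hα0 (Nat.one_le_cast.2 hm1)).trans (le_of_lt hδ)
        have hαρ : alpha C N * max 1 δ⁻¹ ≤ 1 := by
          rw [mul_max_of_nonneg _ _ hα0, mul_one, ← div_eq_mul_inv]
          exact max_le hα ((div_le_one hδ0).2 hαδ)
        gcongr
  have hlim : (1 + Real.exp 1) * m * alpha C N =
      m * alpha C N + m * (alpha C N * Real.exp 1) := by ring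
  rw [hlim]
  have hcont : Continuous fun δ : ℝ => (δ + m * (alpha C N * Real.exp 1)) ^ I.card := by fun_prop
  exact ge_of_tendsto ((hcont.tendsto _).mono_left nhdsWithin_le_nhds)
    (eventually_mem_nhdsWithin.mono hbound)

end Noise

lemma HasEffectiveNoiseStrength.mono {Q L B : Type*} [Fintype Q] [DecidableEq Q]
    [NormedAddCommGroup B] [InnerProductSpace ℂ B] [CompleteSpace B] {C : Circuit Q L}
    {N : Noise Q B} {U₀ : ℝ → JointOp Q B} {ε ε' : ℝ} (h : HasEffectiveNoiseStrength C N U₀ ε)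
    (hε : 0 ≤ ε) (hεε' : ε ≤ ε') : HasEffectiveNoiseStrength C N U₀ ε' := fun I =>
  have ⟨E, hE, hle⟩ := h I
  ⟨E, hE, hle.trans (pow_le_pow_left₀ hε hεε' _)⟩

lemma one_add_exp_mul_le_strengthBound (m : ℕ) {a : ℝ} (ha : 0 ≤ a) (ha' : 2 * a < 1) :
    (1 + Real.exp 1) * m * a ≤ strengthBound m a := by
  have hbase : 1 + Real.exp 1 ≤ 2 * Real.exp ((Real.exp 1 - 1) / 2) := by
    linarith [Real.add_one_le_exp ((Real.exp 1 - 1) / 2)]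
  have hpow : Real.exp ((Real.exp 1 - 1) / 2) ≤
      Real.exp ((Real.exp 1 - 1) / 2) ^ (1 - 2 * a)⁻¹ := by
    refine Real.self_le_rpow_of_one_le ?_ ((one_le_inv₀ (by linarith)).2 (by linarith))
    linarith [Real.add_one_le_exp (1 : ℝ)]
  calc (1 + Real.exp 1) * m * a
      ≤ 2 * Real.exp ((Real.exp 1 - 1) / 2) ^ (1 - 2 * a)⁻¹ * m * a := by
        gcongr
        linarith
    _ = strengthBound m a := by rw [strengthBound]; ring

lemma tendsto_strengthBound_div (m : ℕ) :
    Tendsto (fun a : ℝ => strengthBound m a / a) (𝓝[>] 0)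
      (𝓝 (2 * Real.exp ((Real.exp 1 - 1) / 2) * m)) := by
  have hcont : ContinuousAt
      (fun a : ℝ => 2 * Real.exp ((Real.exp 1 - 1) / 2) ^ (1 - 2 * a)⁻¹ * m) 0 := by
    refine .mul (.mul continuousAt_const ?_) continuousAt_const
    exact .rpow continuousAt_const (.inv₀ (by fun_prop) (by norm_num)) (.inl (Real.exp_pos _).ne')
  have hlim := hcont.tendsto
  simp only [mul_zero, sub_zero, inv_one, Real.rpow_one] at hlim
  refine (hlim.mono_left nhdsWithin_le_nhds).congr' ?_
  filter_upwards [self_mem_nhdsWithin] with a ha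
  have hne : a ≠ 0 := ne_of_gt ha
  rw [strengthBound]
  field_simp

lemma abs_two_mul_exp_sub_lt : |2 * Real.exp ((Real.exp 1 - 1) / 2) - 4.72| < 0.005 := by
  have hlower : Real.exp 0.8591 ≤ Real.exp ((Real.exp 1 - 1) / 2) :=
    Real.exp_le_exp.2 (by linarith [Real.exp_one_gt_d9])
  have hupper : Real.exp ((Real.exp 1 - 1) / 2) ≤ Real.exp 0.8592 :=
    Real.exp_le_exp.2 (by linarith [Real.exp_one_lt_d9])
  have hsum := Real.sum_le_exp_of_nonneg (x := 0.8591) (by norm_num) 7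
  have hbound := Real.exp_bound' (x := 0.8592) (by norm_num) (by norm_num) (n := 7) (by norm_num)
  norm_num [Finset.sum_range_succ, Nat.factorial] at hsum hbound
  rw [abs_lt]
  constructor <;> linarith

end

end CorrelatedNoise

open CorrelatedNoise in
theorem corollary1_general {Q L B : Type*} [Fintype Q] [DecidableEq Q] [NormedAddCommGroup B]
    [InnerProductSpace ℂ B] [CompleteSpace B] (C : Circuit Q L) (N : Noise Q B)
    {H : ℝ → (JointSpace Q B →ₗ.[ℂ] JointSpace Q B)} {U₀ : ℝ → JointOp Q B}
    (hU₀ : IsEvolution H U₀) {m : ℕ} (hm : ∀ l, (C.qubits l).card ≤ m) (hα : alpha C N ≤ 1) :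
    HasEffectiveNoiseStrength C N U₀ ((1 + Real.exp 1) * m * alpha C N) := fun I =>
  ⟨_, N.isFaultSum C hU₀.unitary_mem hU₀.continuous I,
    N.norm_faultSum_le_pow C hU₀.unitary_mem hU₀.continuous hα hm I⟩

open CorrelatedNoise in
theorem corollary1 {Q L B : Type*} [Fintype Q] [DecidableEq Q] [Fintype L]
    [NormedAddCommGroup B] [InnerProductSpace ℂ B] [CompleteSpace B]
    (C : Circuit Q L) (N : Noise Q B) (U₀ : ℝ → JointOp Q B)
    (hU₀ : IsEvolution (fun t => freeHamiltonian (C.systemHamiltonian t) (N.bath t)) U₀)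
    (m : ℕ) (hm : ∀ l, (C.qubits l).card ≤ m) (hα : 2 * alpha C N < 1) :
    HasEffectiveNoiseStrength C N U₀ (strengthBound m (alpha C N)) ∧
      (Tendsto (fun a : ℝ => strengthBound m a / a) (𝓝[>] 0)
          (𝓝 (2 * Real.exp ((Real.exp 1 - 1) / 2) * m)) ∧
        |2 * Real.exp ((Real.exp 1 - 1) / 2) - 4.72| < 0.005) := by
  have hα0 := alpha_nonneg C N
  exact ⟨(corollary1_general C N hU₀ hm (by linarith)).mono (by positivity)
    (one_add_exp_mul_le_strengthBound m hα0 hα), tendsto_strengthBound_div m,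
    abs_two_mul_exp_sub_lt⟩
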